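/- Let $N=\{1,\dots,n\}$ be consumers and $V=\{1,\dots,m\}$ suppliers. Each consumer $i$ has a system of choice probabilities over $V$: for every menu $S\subseteq V$, a probability distribution $(p_{ia}(S))_{a\in S\cup\{0\}}$, where $0$ is the outside option. Each supplier $j$ likewise has a system $(q_{ja}(C))_{a\in C\cup\{0\}}$, $C\subseteq N$, with demand function $Q_j(C)=\sum_{i\in C}q_{ji}(C)$, and a revenue $r_j\ge 0$. Given menus $S=(S_1,\dots,S_n)$, $S_i\subseteq V$, the consumers choose independently, $i$ choosing $j\in S_i$ with probability $p_{ij}(S_i)$ and nobody with probability $p_{i0}(S_i)$; then the suppliers choose independently, $j$ choosing $i$ from the set $C_j$ of consumers that chose $j$ with probability $q_{ji}(C_j)$ and nobody with probability $q_{j0}(C_j)$. The pairs that chose each other are matched; let $\mathbf M_S$ be the sum of $r_j$ over the matched suppliers $j$. Let $\mathrm{OPT}$ be the maximum of $\mathbb E[\mathbf M_S]$ over the feasible families $S$, where either all families are feasible (unconstrained problem) or, for given budgets $K_i\in\mathbb Z_{\ge 0}$, those with $|S_i|\le K_i$ for all $i\in N$. Consumer $i$ is easy-to-match if $p_{ij}(\{j\})\ge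 p_{i0}(\{j\})$ for all $j\in V$. Supplier $j$ follows a random utility-based model if there are real random variables $U_0,U_1,\dots,U_n$ with a joint law under which $\mathbb P(U_a=U_b)=0$ for $a\ne b$, and $q_{ja}(C)=\mathbb P(U_a=\max\{U_b:b\in C\cup\{0\}\})$ for all $C\subseteq N$ and $a\in C\cup\{0\}$. Then there is a randomized algorithm which, given $n$, $m$, the revenues, the budgets (if any) and value-oracle access to the demand functions $Q_1,\dots,Q_m$ (unit-cost operations on real numbers and unit-cost oracle queries), runs in time polynomial in $n+m$ and, whenever every consumer is easy-to-match and every supplier follows a random utility-based model, always outputs a feasible family $S$, with $$\mathbb E[\mathbf M_S]\ \ge\ \frac{1-e^{-1}}{2}\cdot\mathrm{OPT},$$ where the expectation is also over the randomness of the algorithm. (The running time and feasibility are claimed on these instances.) -/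

import Mathlib

/-! ## The two-sided sequential assortment problem -/

namespace Assortment

/-- A system of choice probabilities on the options `E`; `none` is the outside option.
`prob a S` is the probability that the agent chooses `a` when shown the menu `S`: for every menu
`S` it is a probability distribution supported on `S ∪ {outside option}`. -/
structure ChoiceSystem (E : Type) where
  prob : Option E → Finset E → ℝ
  prob_nonneg : ∀ a S, 0 ≤ prob a S
  prob_eq_zero : ∀ (e : E) (S : Finset E), e ∉ S → prob (some e) S = 0
  sum_prob : ∀ S : Finset E, (∑ e ∈ S, prob (some e) S) + prob none S = 1

namespace ChoiceSystem

variable {E : Type}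

/-- The demand function: the probability that some option of the menu is chosen. -/
def demand (q : ChoiceSystem E) (S : Finset E) : ℝ :=
  ∑ e ∈ S, q.prob (some e) S

/-- Easy-to-match: facing a single option, the agent chooses it with at least the probability of
remaining unmatched. -/
def EasyToMatch (q : ChoiceSystem E) : Prop :=
  ∀ e : E, q.prob none {e} ≤ q.prob (some e) {e}

/-- The choice system is a random utility-based model: there is a joint probability law `D` of
real utilities of all options and of the outside option, almost surely without ties, such that the
agent chooses the option of highest utility among the menu and the outside option. -/
def IsRandomUtility (q : ChoiceSystem E) : Prop :=
  ∃ D : MeasureTheory.Measure (Option E → ℝ), MeasureTheory.IsProbabilityMeasure D ∧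
    (∀ a b : Option E, a ≠ b → D {U | U a = U b} = 0) ∧
    ∀ (S : Finset E) (a : Option E), a ∈ Finset.insertNone S →
      q.prob a S = (D {U | ∀ b ∈ Finset.insertNone S, U b ≤ U a}).toReal

end ChoiceSystem

/-- An instance with consumers `Fin n` and suppliers `Fin m`. -/
structure Instance (n m : ℕ) where
  /-- the choice system of each consumer, over suppliers -/
  consumer : Fin n → ChoiceSystem (Fin m)
  /-- the choice system of each supplier, over consumers -/
  supplier : Fin m → ChoiceSystem (Fin n)
  /-- the revenue obtained when a supplier is matched -/
  revenue : Fin m → ℝ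
  revenue_nonneg : ∀ j, 0 ≤ revenue j
  /-- `none`: the unconstrained problem; `some K`: consumer `i` may be shown at most `K i`
  suppliers -/
  budget : Option (Fin n → ℕ)

/-- An assortment family (menu profile): a menu of suppliers for every consumer. -/
abbrev Family (n m : ℕ) : Type := Fin n → Finset (Fin m)

namespace Instance

variable {n m : ℕ}

/-- Feasible assortment families. -/
def Feasible (I : Instance n m) (S : Family n m) : Prop :=
  ∀ K, I.budget = some K → ∀ i, (S i).card ≤ K i

/-- Given the choices `c` made by the consumers in the first step, the set of consumers that
chose supplier `j`. -/
def applicants (c : Fin n → Option (Fin m)) (j : Fin m) : Finset (Fin n) :=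
  Finset.univ.filter fun i => c i = some j

/-- Probability of the choices `c` of the (independent) consumers when shown the family `S`. -/
noncomputable def firstProb (I : Instance n m) (S : Family n m) (c : Fin n → Option (Fin m)) : ℝ :=
  ∏ i, (I.consumer i).prob (c i) (S i)

/-- Probability of the choices `d` of the (independent) suppliers, each of which chooses among the
consumers that chose it in the first step. -/
noncomputable def secondProb (I : Instance n m) (c : Fin n → Option (Fin m))
    (d : Fin m → Option (Fin n)) : ℝ :=
  ∏ j, (I.supplier j).prob (d j) (applicants c j)

/-- Revenue of the resulting matching: `i` and `j` are matched if they chose each other. -/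
noncomputable def matchingRevenue (I : Instance n m) (c : Fin n → Option (Fin m))
    (d : Fin m → Option (Fin n)) : ℝ :=
  ∑ i, ∑ j, if c i = some j ∧ d j = some i then I.revenue j else 0

/-- Expected revenue of the matching produced by the two-step process for the family `S`. -/
noncomputable def expectedRevenue (I : Instance n m) (S : Family n m) : ℝ :=
  ∑ c : Fin n → Option (Fin m), I.firstProb S c *
    ∑ d : Fin m → Option (Fin n), I.secondProb c d * I.matchingRevenue c d

/-- The optimal value: the largest expected revenue of a feasible family (there are finitely many
families, and the family of empty menus is feasible). -/
noncomputable def opt (I : Instance n m) : ℝ :=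
  sSup (I.expectedRevenue '' {S | I.Feasible S})

end Instance

/-! ## Randomized real random access programs with a value oracle

Memory consists of arrays of natural numbers and arrays of reals; an array is named by a number and
has two indices. Natural numbers can only be added, subtracted and compared, and reals only be
added, subtracted, multiplied and compared, each in one time unit. A program is one finite text,
which serves inputs of all sizes. -/

/-- Natural number expressions; `get a i j` reads cell `(i, j)` of the array `a`. -/
inductive NatExpr where
  | const (k : ℕ)
  | get (a : ℕ) (i j : NatExpr)
  | add (e f : NatExpr)
  | sub (e f : NatExpr)

/-- Real expressions; `get a i j` reads cell `(i, j)` of the array `a`. -/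
inductive RealExpr where
  | const (k : ℤ)
  | get (a : ℕ) (i j : NatExpr)
  | add (e f : RealExpr)
  | sub (e f : RealExpr)
  | mul (e f : RealExpr)

/-- Tests. -/
inductive Test where
  | natLe (e f : NatExpr)
  | realLe (e f : RealExpr)
  | neg (t : Test)
  | conj (t u : Test)

/-- Programs. -/
inductive Program where
  | skip
  /-- write the value of `e` into cell `(i, j)` of the natural number array `a` -/
  | setNat (a : ℕ) (i j : NatExpr) (e : NatExpr)
  /-- write the value of `e` into cell `(i, j)` of the real array `a` -/
  | setReal (a : ℕ) (i j : NatExpr) (e : RealExpr)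
  /-- write a fresh fair random bit into cell `(i, j)` of the natural number array `a` -/
  | flip (a : ℕ) (i j : NatExpr)
  /-- write into cell `(i, j)` of the real array `a` the answer of the oracle with number `e` to
  the set whose indicator is row `row` of the natural number array `b` -/
  | query (a : ℕ) (i j : NatExpr) (e : NatExpr) (b : ℕ) (row : NatExpr)
  | seq (p q : Program)
  | ite (t : Test) (p q : Program)
  /-- run `p` with cell `(0, 0)` of the natural number array `x` set to `0, 1, ..., e - 1` in
  turn; the number `e` of rounds is evaluated once, at the beginning -/
  | loop (x : ℕ) (e : NatExpr) (p : Program)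

/-- Contents of the memory, and the number of time units spent so far. -/
structure Memory where
  nat : ℕ → ℕ → ℕ → ℕ
  real : ℕ → ℕ → ℕ → ℝ
  clock : ℕ

namespace Memory

/-- Write a natural number. -/
def writeNat (s : Memory) (a i j v : ℕ) : Memory :=
  { s with nat := fun a' i' j' => if a' = a ∧ i' = i ∧ j' = j then v else s.nat a' i' j' }

/-- Write a real number. -/
noncomputable def writeReal (s : Memory) (a i j : ℕ) (v : ℝ) : Memory :=
  { s with real := fun a' i' j' => if a' = a ∧ i' = i ∧ j' = j then v else s.real a' i' j' }

/-- Spend `k` time units. -/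
def tick (s : Memory) (k : ℕ) : Memory :=
  { s with clock := s.clock + k }

end Memory

/-- Value of an expression. -/
def NatExpr.eval (s : Memory) : NatExpr → ℕ
  | .const k => k
  | .get a i j => s.nat a (i.eval s) (j.eval s)
  | .add e f => e.eval s + f.eval s
  | .sub e f => e.eval s - f.eval s

/-- Time to evaluate an expression: its number of nodes. -/
def NatExpr.cost : NatExpr → ℕ
  | .const _ => 1
  | .get _ i j => i.cost + j.cost + 1
  | .add e f => e.cost + f.cost + 1
  | .sub e f => e.cost + f.cost + 1

/-- Value of an expression. -/
noncomputable def RealExpr.eval (s : Memory) : RealExpr → ℝ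
  | .const k => (k : ℝ)
  | .get a i j => s.real a (i.eval s) (j.eval s)
  | .add e f => e.eval s + f.eval s
  | .sub e f => e.eval s - f.eval s
  | .mul e f => e.eval s * f.eval s

/-- Time to evaluate an expression: its number of nodes. -/
def RealExpr.cost : RealExpr → ℕ
  | .const _ => 1
  | .get _ i j => i.cost + j.cost + 1
  | .add e f => e.cost + f.cost + 1
  | .sub e f => e.cost + f.cost + 1
  | .mul e f => e.cost + f.cost + 1

/-- Truth value of a test. -/
def Test.Holds (s : Memory) : Test → Prop
  | .natLe e f => e.eval s ≤ f.eval s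
  | .realLe e f => e.eval s ≤ f.eval s
  | .neg t => ¬ t.Holds s
  | .conj t u => t.Holds s ∧ u.Holds s

/-- Time to evaluate a test. -/
def Test.cost : Test → ℕ
  | .natLe e f => e.cost + f.cost + 1
  | .realLe e f => e.cost + f.cost + 1
  | .neg t => t.cost + 1
  | .conj t u => t.cost + u.cost + 1

/-- A numbered family of real functions of sets of numbers. -/
abbrev Oracle : Type := ℕ → Set ℕ → ℝ

/-- `rounds f k` runs `f 0`, `f 1`, ..., `f (k - 1)` one after the other. -/
noncomputable def rounds (f : ℕ → Memory → PMF Memory) : ℕ → Memory → PMF Memory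
  | 0, s => PMF.pure s
  | k + 1, s => (rounds f k s).bind (f k)

open Classical in
/-- The distribution of the memory after running a program, over its own random bits. -/
noncomputable def Program.run (Q : Oracle) : Program → Memory → PMF Memory
  | .skip, s => PMF.pure (s.tick 1)
  | .setNat a i j e, s =>
      PMF.pure ((s.writeNat a (i.eval s) (j.eval s) (e.eval s)).tick
        (i.cost + j.cost + e.cost + 1))
  | .setReal a i j e, s =>
      PMF.pure ((s.writeReal a (i.eval s) (j.eval s) (e.eval s)).tick
        (i.cost + j.cost + e.cost + 1))
  | .flip a i j, s =>
      (PMF.uniformOfFintype Bool).map fun b =>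
        (s.writeNat a (i.eval s) (j.eval s) b.toNat).tick (i.cost + j.cost + 1)
  | .query a i j e b row, s =>
      PMF.pure ((s.writeReal a (i.eval s) (j.eval s)
        (Q (e.eval s) {k | s.nat b (row.eval s) k ≠ 0})).tick
          (i.cost + j.cost + e.cost + row.cost + 1))
  | .seq p q, s => (p.run Q s).bind (q.run Q)
  | .ite t p q, s =>
      if t.Holds s then p.run Q (s.tick (t.cost + 1)) else q.run Q (s.tick (t.cost + 1))
  | .loop x e p, s =>
      rounds (fun k s' => p.run Q ((s'.writeNat x 0 0 k).tick 1)) (e.eval s) (s.tick (e.cost + 1))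

namespace Instance

variable {n m : ℕ}

open Classical in
/-- The value oracle of the instance: number `j` answers with the demand function of supplier `j`;
a number that is not a supplier, or a member that is not a consumer, is ignored. -/
noncomputable def oracle (I : Instance n m) : Oracle := fun j A =>
  if h : j < m then
    (I.supplier ⟨j, h⟩).demand (Finset.univ.filter fun i : Fin n => (i : ℕ) ∈ A)
  else 0

/-- The input, at time `0`. Cell `(0, 0)` of the natural number arrays `0`, `1`, `2` holds the
number of consumers, the number of suppliers, and `1` or `0` according to whether there are
cardinality budgets; row `0` of the natural number array `3` holds the budgets, and row `0` of the
real array `0` the revenues. Every other cell is `0`. -/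
def input (I : Instance n m) : Memory where
  nat a i j :=
    if a = 0 ∧ i = 0 ∧ j = 0 then n
    else if a = 1 ∧ i = 0 ∧ j = 0 then m
    else match I.budget with
      | none => 0
      | some K =>
        if a = 2 ∧ i = 0 ∧ j = 0 then 1
        else if h : a = 3 ∧ i = 0 ∧ j < n then K ⟨j, h.2.2⟩ else 0
  real a i j := if h : a = 0 ∧ i = 0 ∧ j < m then I.revenue ⟨j, h.2.2⟩ else 0
  clock := 0

end Instance

/-- The output: supplier `j` is on the menu of consumer `i` if cell `(i, j)` of the natural number
array `4` is not `0`. -/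
def output (n m : ℕ) (s : Memory) : Family n m := fun i =>
  Finset.univ.filter fun j : Fin m => s.nat 4 i j ≠ 0

/-- The distribution of the final memory of the program on an instance. The program receives the
numbers of agents, the revenues and the budgets, and reaches the choice models only through value
queries to the demand functions of the suppliers. -/
noncomputable def Program.finalMemory {n m : ℕ} (P : Program) (I : Instance n m) : PMF Memory :=
  P.run I.oracle I.input

/-- The distribution of the assortment family that the program outputs on an instance. -/
noncomputable def Program.outputLaw {n m : ℕ} (P : Program) (I : Instance n m) :
    PMF (Family n m) :=
  (P.finalMemory I).map (output n m)

/-- Expected revenue of the family that the program outputs, over the random bits of the program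
and over the choices of consumers and suppliers. -/
noncomputable def Program.expectedRevenue {n m : ℕ} (P : Program) (I : Instance n m) : ℝ :=
  ∑ S : Family n m, (P.outputLaw I S).toReal * I.expectedRevenue S

end Assortment

/-! ### Coverage functions. -/

namespace Assortment

open Finset

/-! The problem reduces to assigning every consumer to at most one supplier. For an assignment ρ let
f(ρ) = `value ρ` be the total of revenue times demand over the sets of consumers assigned to each
supplier. Given the consumers' choices, the conditional expected revenue is f of these choices, so
OPT is at most the maximum W of f over assignments of eligible consumers (`opt_le`). Conversely,
offering each consumer only its assigned supplier earns at least f(ρ)/2 (`half_value_le`), because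
an easy-to-match consumer accepts a single offer with probability at least 1/2. It remains to find ρ
with mean value at least (1 - 1/e) W.

Under random utility, the demand of C is the probability that the random set of consumers preferred
to the outside option meets C. Hence demands are coverage functions (`isCoverage`) and f is monotone
and submodular. The algorithm is a discretized continuous greedy method. A table with T = 2 ^ L ≥ 2n
columns encodes a random assignment, each consumer drawing an independent uniform entry of its row;
`mix` is the mean of f. Columns are filled in turn, and within a column the consumers in turn, each
receiving the supplier with the largest sampled marginal gain. Since the updates are sequential, the
gains promised by an optimal assignment can be measured in the updated table (`roundPotential`). Up
to sampling error one column then gives F_old - W ≤ (1 + 1/T)(F_new - W), so T columns shrink the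
deficit W - F by (1 + 1/T)^(-T) ≤ (1 + 1/T)/e.

To lose nothing against 1 - 1/e, one pair is fixed in all columns beforehand, and all pairs are
tried. Some pair of the optimum is worth at least W/n, and this head start outweighs the errors of
discretization and sampling, both of order W/n (`one_sub_exp_mul_le`). The sampling error is
controlled in mean by second moments (`le_E_choose`), without tail bounds. Sampled assignments are
evaluated exactly and the best one is kept, so the other attempts do no harm.

The program itself is analysed on its finite tree of coin tosses: invariants hold on all leaves,
means are bounded by potentials that do not decrease in expectation (`le_E_loop`), and the running
time is bounded syntactically (`all_clock_le`). -/

theorem ite_sub_ite_le_ite_sub_ite {a b c d : Prop} [Decidable a] [Decidable b] [Decidable c]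
    [Decidable d] (h1 : d → b) (h2 : d → c) (h3 : a → ¬ b → c) :
    (if a then (1 : ℝ) else 0) - (if b then 1 else 0) ≤
      (if c then 1 else 0) - (if d then 1 else 0) := by
  by_cases a <;> by_cases b <;> by_cases c <;> by_cases d <;> simp_all

/-- A coverage function: a nonnegative combination of the indicators of meeting a given set. -/
def IsCoverage {α : Type} [Fintype α] [DecidableEq α] (q : Finset α → ℝ) : Prop :=
  ∃ w : Finset α → ℝ, (∀ U, 0 ≤ w U) ∧
    ∀ C, q C = ∑ U, w U * if (U ∩ C).Nonempty then 1 else 0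

namespace IsCoverage

variable {α : Type} [Fintype α] [DecidableEq α] {q : Finset α → ℝ}

theorem nonneg (h : IsCoverage q) (C : Finset α) : 0 ≤ q C := by
  obtain ⟨w, hw, h⟩ := h
  rw [h]
  exact sum_nonneg fun U _ => mul_nonneg (hw U) (by split_ifs <;> norm_num)

theorem empty (h : IsCoverage q) : q ∅ = 0 := by
  obtain ⟨w, hw, h⟩ := h
  rw [h]
  simp

theorem mono (h : IsCoverage q) {C C' : Finset α} (hC : C ⊆ C') : q C ≤ q C' := by
  obtain ⟨w, hw, h⟩ := h
  rw [h, h]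
  refine sum_le_sum fun U _ => mul_le_mul_of_nonneg_left ?_ (hw U)
  have : (U ∩ C).Nonempty → (U ∩ C').Nonempty := fun hn => hn.mono (inter_subset_inter_left hC)
  split_ifs <;> first | (exfalso; tauto) | norm_num

/-- It suffices to look at one covering set U. If U meets A, the right side is already at least 1;
if U meets only O, an element of U in O \ A has marginal 1. Erasing k is idle here, but it gives the
marginals the form that they have in `gain_eq`. -/
theorem le_add_sum_marginals (h : IsCoverage q) (A O : Finset α) :
    q O ≤ q A + ∑ k ∈ O \ A, (q (insert k A) - q (A.erase k)) := by
  obtain ⟨w, hw, h⟩ := h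
  simp only [h]
  simp_rw [← sum_sub_distrib, ← mul_sub]
  rw [sum_comm, ← sum_add_distrib]
  simp_rw [← mul_sum, ← mul_add]
  refine sum_le_sum fun U _ => mul_le_mul_of_nonneg_left ?_ (hw U)
  have key : ∀ k, (0 : ℝ) ≤ (if (U ∩ insert k A).Nonempty then (1 : ℝ) else 0)
      - (if (U ∩ A.erase k).Nonempty then 1 else 0) := by
    intro k
    have : (U ∩ A.erase k).Nonempty → (U ∩ insert k A).Nonempty := fun hn =>
      hn.mono (inter_subset_inter_left ((erase_subset _ _).trans (subset_insert _ _)))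
    split_ifs <;> first | (exfalso; tauto) | norm_num
  by_cases hA : (U ∩ A).Nonempty
  · rw [if_pos hA]
    have := sum_nonneg fun k (_ : k ∈ O \ A) => key k
    split_ifs <;> linarith
  · rw [if_neg hA]
    by_cases hO : (U ∩ O).Nonempty
    · rw [if_pos hO, zero_add]
      obtain ⟨k, hk⟩ := hO
      rw [mem_inter] at hk
      have hkA : k ∉ A := fun hkA => hA ⟨k, mem_inter.2 ⟨hk.1, hkA⟩⟩
      have h1 := single_le_sum (fun k (_ : k ∈ O \ A) => key k) (mem_sdiff.2 ⟨hk.2, hkA⟩)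
      rw [erase_eq_of_notMem hkA, if_neg hA,
        if_pos ⟨k, mem_inter.2 ⟨hk.1, mem_insert_self _ _⟩⟩] at h1
      linarith
    · rw [if_neg hO, zero_add]
      exact sum_nonneg fun k _ => key k

/-- For one covering set U, the marginal of k is 1 exactly when k lies in U and no other element of
U lies in A; enlarging A can only destroy this. -/
theorem marginal_antitone (h : IsCoverage q) {A A' : Finset α} (hA : A ⊆ A') (k : α) :
    q (insert k A') - q (A'.erase k) ≤ q (insert k A) - q (A.erase k) := by
  obtain ⟨w, hw, h⟩ := h
  simp only [h]
  simp_rw [← sum_sub_distrib, ← mul_sub]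
  refine sum_le_sum fun U _ => mul_le_mul_of_nonneg_left ?_ (hw U)
  have h1 : (U ∩ A.erase k).Nonempty → (U ∩ A'.erase k).Nonempty := fun hn =>
    hn.mono (inter_subset_inter_left (erase_subset_erase _ hA))
  have h2 : (U ∩ A.erase k).Nonempty → (U ∩ insert k A).Nonempty := fun hn =>
    hn.mono (inter_subset_inter_left ((erase_subset _ _).trans (subset_insert _ _)))
  have h3 : (U ∩ insert k A').Nonempty → ¬ (U ∩ A'.erase k).Nonempty →
      (U ∩ insert k A).Nonempty := by
    rintro ⟨x, hx⟩ hn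
    rw [mem_inter, mem_insert] at hx
    refine ⟨k, mem_inter.2 ⟨?_, mem_insert_self _ _⟩⟩
    by_cases hxk : x = k
    · exact hxk ▸ hx.1
    · exact absurd ⟨x, mem_inter.2 ⟨hx.1, mem_erase.2 ⟨hxk, hx.2.resolve_left hxk⟩⟩⟩ hn
  exact ite_sub_ite_le_ite_sub_ite h1 h2 h3

theorem marginal_nonneg (h : IsCoverage q) (A : Finset α) (k : α) :
    0 ≤ q (insert k A) - q (A.erase k) :=
  sub_nonneg.2 (h.mono ((erase_subset _ _).trans (subset_insert _ _)))

end IsCoverage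

/-! ### Reduction to assignments of consumers to suppliers. -/

/-- Marginal of a product distribution. -/
theorem sum_prod_mul {ι β : Type} [Fintype ι] [DecidableEq ι] [Fintype β]
    (p : ι → β → ℝ) (hp : ∀ i, ∑ b, p i b = 1) (i₀ : ι) (g : β → ℝ) :
    ∑ c : ι → β, (∏ i, p i (c i)) * g (c i₀) = ∑ b, p i₀ b * g b := by
  classical
  have h := Fintype.prod_sum (fun i b => p i b * if i = i₀ then g b else 1)
  have h1 : ∀ c : ι → β, ∏ i, (p i (c i) * if i = i₀ then g (c i) else 1)
      = (∏ i, p i (c i)) * g (c i₀) := by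
    intro c
    rw [prod_mul_distrib, Finset.prod_ite_eq' univ i₀ (fun i => g (c i))]
    simp
  simp_rw [h1] at h
  rw [← h, Finset.prod_eq_single i₀]
  · simp
  · intro i _ hi
    simp [hi, hp]
  · simp

theorem ChoiceSystem.sum_prob_univ {E : Type} [Fintype E] (q : ChoiceSystem E) (S : Finset E) :
    ∑ a : Option E, q.prob a S = 1 := by
  classical
  rw [Fintype.sum_option, add_comm, ← q.sum_prob S]
  congr 1
  symm
  refine sum_subset (subset_univ _) fun e _ he => q.prob_eq_zero e S he

namespace Instance

variable {n m : ℕ} (I : Instance n m)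

/-- The value of assigning consumer `k` to supplier number `ρ k - 1` (to nobody if there is no such
supplier), when every consumer accepts. -/
noncomputable def value (ρ : Fin n → ℕ) : ℝ :=
  ∑ j : Fin m, I.revenue j * (I.supplier j).demand (univ.filter fun k => ρ k = j + 1)

/-- The consumers that may be shown some supplier. -/
def Eligible (i : Fin n) : Prop := ∀ K, I.budget = some K → 1 ≤ K i

/-- The menus that offer every consumer the supplier assigned to it. -/
def menus (ρ : Fin n → ℕ) : Family n m := fun i => univ.filter fun j => ρ i = j + 1

theorem sum_firstProb (S : Family n m) : ∑ c, I.firstProb S c = 1 := by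
  unfold firstProb
  rw [← Fintype.prod_sum (fun i a => (I.consumer i).prob a (S i))]
  exact prod_eq_one fun i _ => ChoiceSystem.sum_prob_univ _ _

theorem firstProb_nonneg (S : Family n m) (c) : 0 ≤ I.firstProb S c :=
  prod_nonneg fun _ _ => ChoiceSystem.prob_nonneg _ _ _

/-- Linearity of expectation: a supplier chooses at most one applicant, so its chance of being
matched is the sum of its choice probabilities over the applicants, which is the demand. The other
suppliers integrate out by `sum_prod_mul`. -/
theorem sum_secondProb_mul (c : Fin n → Option (Fin m)) :
    ∑ d, I.secondProb c d * I.matchingRevenue c d =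
      ∑ j, I.revenue j * (I.supplier j).demand (applicants c j) := by
  classical
  have h1 : ∀ d, I.secondProb c d * I.matchingRevenue c d =
      ∑ j, ∑ i, (if c i = some j then I.revenue j else 0) *
        ((∏ j, (I.supplier j).prob (d j) (applicants c j)) * if d j = some i then 1 else 0) := by
    intro d
    unfold secondProb matchingRevenue
    rw [sum_comm, mul_sum]
    refine sum_congr rfl fun j _ => ?_
    rw [mul_sum]
    refine sum_congr rfl fun i _ => ?_
    by_cases h1 : c i = some j <;> by_cases h2 : d j = some i <;> simp [h1, h2, mul_comm]
  simp_rw [h1]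
  rw [sum_comm]
  refine sum_congr rfl fun j _ => ?_
  rw [sum_comm, ChoiceSystem.demand, mul_sum, applicants, sum_filter]
  refine sum_congr rfl fun i _ => ?_
  rw [← mul_sum]
  rw [sum_prod_mul (fun j a => (I.supplier j).prob a (applicants c j))
    (fun j => ChoiceSystem.sum_prob_univ _ _) j (fun a => if a = some i then 1 else 0)]
  by_cases h : c i = some j <;> simp [h, applicants]

theorem expectedRevenue_eq (S : Family n m) :
    I.expectedRevenue S =
      ∑ c, I.firstProb S c * ∑ j, I.revenue j * (I.supplier j).demand (applicants c j) := by
  unfold expectedRevenue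
  simp_rw [sum_secondProb_mul]

/-- The expected revenue is an average of values of assignments. Choices of positive probability
stay within the menus, so a consumer that chooses somebody has a nonempty menu and is therefore
eligible. -/
theorem expectedRevenue_le {V : ℝ} (hV : ∀ ρ, (∀ i, ρ i ≠ 0 → I.Eligible i) → I.value ρ ≤ V)
    (S : Family n m) (hS : I.Feasible S) : I.expectedRevenue S ≤ V := by
  classical
  rw [expectedRevenue_eq]
  have : V = ∑ c, I.firstProb S c * V := by rw [← sum_mul, sum_firstProb, one_mul]
  rw [this]
  refine sum_le_sum fun c _ => ?_
  by_cases h0 : I.firstProb S c = 0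
  · simp [h0]
  refine mul_le_mul_of_nonneg_left ?_ (I.firstProb_nonneg S c)
  have hc : ∀ i j, c i = some j → j ∈ S i := by
    intro i j hij
    by_contra hj
    refine h0 (prod_eq_zero (mem_univ i) ?_)
    rw [hij]
    exact ChoiceSystem.prob_eq_zero _ _ _ hj
  have h := hV (fun i => match c i with | none => 0 | some j => j + 1) (by
    intro i hi K hK
    cases hci : c i with
    | none => simp [hci] at hi
    | some j => exact (card_pos.2 ⟨j, hc i j hci⟩).trans_le (hS K hK i))
  refine le_trans (le_of_eq ?_) h
  unfold value
  refine sum_congr rfl fun j _ => ?_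
  congr 2
  unfold applicants
  refine filter_congr fun i _ => ?_
  cases hci : c i with
  | none => simp [hci]
  | some j' => simp [hci, Fin.ext_iff]

theorem opt_le {V : ℝ} (hV : ∀ ρ, (∀ i, ρ i ≠ 0 → I.Eligible i) → I.value ρ ≤ V) :
    I.opt ≤ V := by
  refine csSup_le ⟨_, fun _ => ∅, ?_, rfl⟩ ?_
  · intro K _ i
    simp
  · rintro _ ⟨S, hS, rfl⟩
    exact I.expectedRevenue_le hV S hS

theorem feasible_menus (ρ : Fin n → ℕ) (hρ : ∀ i, ρ i ≠ 0 → I.Eligible i) :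
    I.Feasible (menus ρ) := by
  intro K hK i
  by_cases h : ρ i = 0
  · simp [menus, h]
  · refine le_trans ?_ (hρ i h K hK)
    refine card_le_one.2 fun a ha b hb => ?_
    simp only [menus, mem_filter, mem_univ, true_and] at ha hb
    omega

/-- By linearity one supplier j and one covering set U suffice. If U contains a consumer assigned to
j, that single consumer already applies to j with probability at least 1/2, and then the applicants
meet U. -/
theorem half_value_le (hI : ∀ i, (I.consumer i).EasyToMatch)
    (hq : ∀ j, IsCoverage (I.supplier j).demand) (ρ : Fin n → ℕ) :
    1 / 2 * I.value ρ ≤ I.expectedRevenue (menus ρ) := by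
  classical
  rw [expectedRevenue_eq, value, mul_sum]
  simp_rw [mul_sum]
  rw [sum_comm]
  refine sum_le_sum fun j _ => ?_
  obtain ⟨w, hw, h⟩ := hq j
  simp only [h]
  simp_rw [mul_sum]
  rw [sum_comm]
  refine sum_le_sum fun U _ => ?_
  have key : (1 / 2 : ℝ) * (if (U ∩ univ.filter fun k => ρ k = j + 1).Nonempty then 1 else 0) ≤
      ∑ c, I.firstProb (menus ρ) c * if (U ∩ applicants c j).Nonempty then 1 else 0 := by
    split_ifs with hU
    · obtain ⟨i, hi⟩ := hU
      simp only [mem_inter, mem_filter, mem_univ, true_and] at hi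
      have hS : (menus ρ : Family n m) i = {j} := by
        ext j'
        simp only [menus, mem_filter, mem_univ, true_and, mem_singleton, hi.2, Fin.ext_iff]
        omega
      -- On a singleton menu the two probabilities add up to 1, and accepting is the likelier
      -- outcome.
      have hp : (1 / 2 : ℝ) ≤ (I.consumer i).prob (some j) {j} := by
        have h1 := (I.consumer i).sum_prob {j}
        have h2 := hI i j
        rw [sum_singleton] at h1
        linarith
      have h3 := sum_prod_mul (fun i a => (I.consumer i).prob a ((menus ρ : Family n m) i))
        (fun i => ChoiceSystem.sum_prob_univ _ _) i (fun a => if a = some j then 1 else 0)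
      simp only [mul_ite, mul_one, mul_zero, sum_ite_eq', mem_univ, if_true, hS] at h3
      rw [mul_one]
      refine hp.trans (h3 ▸ sum_le_sum fun c _ => ?_)
      by_cases hc : c i = some j
      · rw [if_pos hc, if_pos ⟨i, mem_inter.2 ⟨hi.1, by simp [applicants, hc]⟩⟩, mul_one]
        rfl
      · rw [if_neg hc]
        exact mul_nonneg (I.firstProb_nonneg _ _) (by split_ifs <;> norm_num)
    · rw [mul_zero]
      exact sum_nonneg fun c _ =>
        mul_nonneg (I.firstProb_nonneg _ _) (by split_ifs <;> norm_num)
  have h4 := mul_le_mul_of_nonneg_left key (mul_nonneg (I.revenue_nonneg j) (hw U))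
  rw [mul_sum] at h4
  calc _ = I.revenue j * w U * (1 / 2 * _) := by ring
    _ ≤ _ := h4
    _ = _ := sum_congr rfl fun c _ => by ring

end Instance

end Assortment

/-! ### Random utility models have coverage demand. -/

namespace Assortment

open Finset MeasureTheory

/-- The outside option is chosen from C exactly when no member of C beats it strictly, that is, when
the random set B of options better than the outside option misses C. The weight of V is therefore
the probability that B = V. -/
theorem ChoiceSystem.IsRandomUtility.isCoverage {n : ℕ} {q : ChoiceSystem (Fin n)}
    (h : q.IsRandomUtility) : IsCoverage q.demand := by
  classical
  obtain ⟨D, hD, hties, hq⟩ := h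
  -- the set of options preferred to the outside option
  let B : (Option (Fin n) → ℝ) → Finset (Fin n) := fun U => univ.filter fun i => U none < U (some i)
  have hmB : ∀ V, MeasurableSet {U | B U = V} := by
    intro V
    have : {U | B U = V} = ⋂ i : Fin n, {U | U none < U (some i) ↔ i ∈ V} := by
      ext U
      simp [B, Finset.ext_iff]
    rw [this]
    refine MeasurableSet.iInter fun i => ?_
    by_cases hi : i ∈ V
    · simp only [hi, iff_true]
      exact measurableSet_lt (measurable_pi_apply _) (measurable_pi_apply _)
    · simp only [hi, iff_false, not_lt]
      exact measurableSet_le (measurable_pi_apply _) (measurable_pi_apply _)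
  refine ⟨fun V => D.real {U | B U = V}, fun V => measureReal_nonneg, fun C => ?_⟩
  have h1 : q.demand C = 1 - q.prob none C := by
    rw [← q.sum_prob C, ChoiceSystem.demand]
    ring
  have h2 : ∀ V C : Finset (Fin n), (V ∩ C).Nonempty ↔ ¬ Disjoint V C := by
    intro V C
    rw [disjoint_iff_inter_eq_empty, nonempty_iff_ne_empty]
  have h3 : ∑ V, D.real {U | B U = V} = 1 := by
    have := measureReal_biUnion_finset (μ := D) (s := univ) (f := fun V => {U | B U = V})
      (by
        intro V _ V' _ hVV
        exact Set.disjoint_left.2 fun U hU hU' => hVV (hU.symm.trans hU'))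
      (fun V _ => hmB V)
    rw [← this]
    have : (⋃ V ∈ (univ : Finset (Finset (Fin n))), {U | B U = V}) = Set.univ := by
      ext U
      simp
    rw [this, probReal_univ]
  have h4 : q.prob none C = ∑ V ∈ univ.filter (fun V => Disjoint V C), D.real {U | B U = V} := by
    have := measureReal_biUnion_finset (μ := D) (s := univ.filter (fun V => Disjoint V C))
      (f := fun V => {U | B U = V})
      (by
        intro V _ V' _ hVV
        exact Set.disjoint_left.2 fun U hU hU' => hVV (hU.symm.trans hU'))
      (fun V _ => hmB V)
    rw [← this, hq C none (by simp)]
    change D.real _ = _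
    congr 1
    ext U
    simp only [Set.mem_ofPred_eq, mem_filter, mem_univ, true_and, Set.mem_iUnion, exists_prop,
      exists_eq_right', mem_insertNone, Finset.disjoint_left, B]
    constructor
    · intro hU i hi hiC
      exact absurd (hU (some i) (by simpa using hiC)) (not_le.2 hi)
    · intro hU b hb
      cases b with
      | none => exact le_rfl
      | some i => exact not_lt.1 fun hi => hU hi (hb i rfl)
  have h5 := sum_filter_add_sum_filter_not univ (fun V => Disjoint V C)
    (fun V => D.real {U | B U = V})
  rw [h1, h4, ← eq_sub_of_add_eq' (h5.trans h3), sum_filter]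
  refine sum_congr rfl fun V _ => ?_
  simp [h2]

end Assortment

/-! ### Averages, sampling errors and the numerical inequality. -/

namespace Assortment

open Finset BigOperators

/-- Resampling one coordinate of a uniformly random function. -/
theorem expect_expect_update {ι β : Type} [Fintype ι] [DecidableEq ι] [Fintype β] [Nonempty β]
    (i : ι) (G : (ι → β) → ℝ) :
    𝔼 x : β, 𝔼 σ : ι → β, G (Function.update σ i x) = 𝔼 σ : ι → β, G σ := by
  have h1 : 𝔼 x : β, 𝔼 σ : ι → β, G (Function.update σ i x) =
      𝔼 p : β × (ι → β), G (Function.update p.2 i p.1) := by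
    rw [← univ_product_univ, expect_product]
  have h2 : 𝔼 σ : ι → β, G σ = 𝔼 p : β × (ι → β), G p.2 := by
    rw [← univ_product_univ, expect_product]
    exact (expect_const univ_nonempty _).symm
  rw [h1, h2]
  refine expect_nbij' (fun p => (p.2 i, Function.update p.2 i p.1))
    (fun p => (p.2 i, Function.update p.2 i p.1)) ?_ ?_ ?_ ?_ ?_ <;> simp

/-- The old deviation a and the centred new sample are orthogonal: the cross term has mean zero, and
the centred sample is at most M in absolute value. -/
theorem expect_sq_add_sub_le {Ω : Type} [Fintype Ω] [Nonempty Ω] {g : Ω → ℝ} {M : ℝ} (a : ℝ)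
    (h0 : ∀ ω, 0 ≤ g ω) (hM : ∀ ω, g ω ≤ M) :
    𝔼 ω, (a + g ω - 𝔼 ω, g ω) ^ 2 ≤ a ^ 2 + M ^ 2 := by
  set D := 𝔼 ω, g ω with hD
  have hD0 : 0 ≤ D := expect_nonneg fun ω _ => h0 ω
  have hDM : D ≤ M := expect_le univ_nonempty fun ω _ => hM ω
  have h1 : ∀ ω, (a + g ω - D) ^ 2 ≤ a ^ 2 + M ^ 2 + 2 * a * (g ω - D) := by
    intro ω
    nlinarith [h0 ω, hM ω]
  calc _ ≤ 𝔼 ω, (a ^ 2 + M ^ 2 + 2 * a * (g ω - D)) := expect_le_expect fun ω _ => h1 ω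
    _ = _ := by
      rw [expect_add_distrib, ← mul_expect, expect_sub_distrib, expect_const univ_nonempty,
        expect_const univ_nonempty, ← hD]
      ring

/-- The largest of the estimates `X j / N` is attained at a nearly largest of the `D j`. -/
theorem le_of_isMax_estimate {κ : Type} [Fintype κ] {X D : κ → ℝ} {N ε : ℝ} (hN : 0 < N)
    (hε : 0 < ε) {b : κ} (hb : ∀ j, X j ≤ X b) (j : κ) :
    D j - ε - (∑ j, (X j - N * D j) ^ 2) / (N ^ 2 * ε) ≤ D b := by
  -- The arithmetic-geometric mean inequality, applied both to the overestimate of b and to the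
  -- underestimate of j. The loss becomes linear in the squared error, so a bound on the mean
  -- squared error is enough later.
  have h1 : ∀ x : ℝ, x ≤ N * ε / 2 + x ^ 2 / (2 * (N * ε)) := by
    intro x
    have : 0 ≤ (x - N * ε) ^ 2 / (2 * (N * ε)) := by positivity
    have h2 : (x - N * ε) ^ 2 / (2 * (N * ε)) = x ^ 2 / (2 * (N * ε)) - x + N * ε / 2 := by
      field_simp
      ring
    linarith
  have h2 : ∀ j, (X j - N * D j) ^ 2 ≤ ∑ j, (X j - N * D j) ^ 2 := fun j =>
    single_le_sum (f := fun j => (X j - N * D j) ^ 2) (fun i _ => sq_nonneg _) (mem_univ j)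
  set S := ∑ j, (X j - N * D j) ^ 2
  have h3 := h1 (X b - N * D b)
  have h4 := h1 (-(X j - N * D j))
  have h5 : ∀ j, (X j - N * D j) ^ 2 / (2 * (N * ε)) ≤ S / (2 * (N * ε)) := fun j =>
    div_le_div_of_nonneg_right (h2 j) (by positivity)
  rw [neg_sq] at h4
  have h6 : N * (D j - D b) ≤ N * ε + 2 * (S / (2 * (N * ε))) := by
    linarith [h5 b, h5 j, hb j]
  have h7 : D j - D b ≤ ε + S / (N ^ 2 * ε) := by
    have : N * ε + 2 * (S / (2 * (N * ε))) = N * (ε + S / (N ^ 2 * ε)) := by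
      field_simp
    rw [this] at h6
    exact le_of_mul_le_mul_left h6 hN
  linarith

/-- Both bounds come from 1 + x ≤ exp x, with x = 1/T and with x = -1/(T+1). In the second case the
inverse of 1 + 1/T is 1 - 1/(T+1), and the power T + 1 costs one extra factor. -/
theorem exp_neg_one_le_pow_inv {T : ℕ} (hT : 0 < T) :
    Real.exp (-1) ≤ ((1 + 1 / (T : ℝ)) ^ T)⁻¹ ∧
      ((1 + 1 / (T : ℝ)) ^ T)⁻¹ ≤ Real.exp (-1) * (1 + 1 / T) := by
  have hT' : (0 : ℝ) < T := by exact_mod_cast hT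
  have ha : (0 : ℝ) < 1 + 1 / T := by positivity
  constructor
  · rw [Real.exp_neg]
    refine inv_anti₀ (by positivity) ?_
    calc (1 + 1 / (T : ℝ)) ^ T ≤ (Real.exp (1 / T)) ^ T := by
          gcongr
          linarith [Real.add_one_le_exp (1 / (T : ℝ))]
      _ = Real.exp 1 := by
          rw [← Real.exp_nat_mul]
          congr 1
          field_simp
  · rw [inv_le_iff_one_le_mul₀ (by positivity)]
    have h1 : (1 + 1 / (T : ℝ)) ^ (T + 1) = (1 - 1 / ((T : ℝ) + 1))⁻¹ ^ (T + 1) := by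
      have : (1 - 1 / ((T : ℝ) + 1)) = T / (T + 1) := by
        field_simp
        ring
      rw [this, inv_div, add_div, div_self hT'.ne']
    have h2 : (1 - 1 / ((T : ℝ) + 1)) ^ (T + 1) ≤ Real.exp (-1) := by
      have h0 : 0 ≤ 1 - 1 / ((T : ℝ) + 1) := by
        rw [sub_nonneg, div_le_one (by positivity)]
        linarith
      calc (1 - 1 / ((T : ℝ) + 1)) ^ (T + 1) ≤ (Real.exp (-(1 / ((T : ℝ) + 1)))) ^ (T + 1) := by
            gcongr
            linarith [Real.add_one_le_exp (-(1 / ((T : ℝ) + 1)))]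
        _ = Real.exp (-1) := by
            rw [← Real.exp_nat_mul]
            congr 1
            push_cast
            field_simp
    have h3 : Real.exp (-1) * (1 + 1 / (T : ℝ)) * (1 + 1 / (T : ℝ)) ^ T =
        Real.exp (-1) * (1 + 1 / (T : ℝ)) ^ (T + 1) := by ring
    rw [h3, h1, inv_pow, ← div_eq_mul_inv, one_le_div]
    · exact h2
    · have : 0 < 1 - 1 / ((T : ℝ) + 1) := by
        rw [sub_pos, div_lt_one (by positivity)]
        linarith
      positivity

/-- Starting from the best single pair compensates for the errors of discretization and
sampling. -/
theorem one_sub_exp_mul_le {n T : ℕ} {W F₀ : ℝ} (hn : 0 < n) (hT : 2 * n ≤ T) (hW : 0 ≤ W)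
    (hF : W / n ≤ F₀) :
    (1 - Real.exp (-1)) * W ≤
      (W - W / (6 * n)) + ((1 + 1 / (T : ℝ)) ^ T)⁻¹ * (F₀ - (W - W / (6 * n))) := by
  obtain ⟨h1, h2⟩ := exp_neg_one_le_pow_inv (show 0 < T by omega)
  set x := ((1 + 1 / (T : ℝ)) ^ T)⁻¹
  set e := Real.exp (-1)
  have hn' : (1 : ℝ) ≤ n := by exact_mod_cast hn
  have hT' : (2 : ℝ) * n ≤ T := by exact_mod_cast hT
  have he : (1 : ℝ) / 3 ≤ e := by
    have := Real.exp_one_lt_d9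
    simp only [e, Real.exp_neg, one_div]
    exact inv_anti₀ (Real.exp_pos 1) (by linarith)
  have he1 : e ≤ 1 := by simp [e]
  have hu : 1 / (T : ℝ) ≤ 1 / (2 * n) := one_div_le_one_div_of_le (by linarith) hT'
  have hx : x ≤ e + e * (1 / (2 * n)) := by nlinarith
  have hu0 : (0 : ℝ) < 1 / (2 * n) := by positivity
  have e1 : W / (6 * n) = W * (1 / (2 * n)) / 3 := by field_simp; ring
  have e2 : W / n = W * (1 / (2 * n)) * 2 := by field_simp
  rw [e1]
  rw [e2] at hF
  -- Scaled to W = 1, the right side is at least 1 - u/3 - x + 7xu/3. With e ≤ x ≤ e(1 + u), where e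
  -- stands for exp(-1), this is at least 1 - e + u(4e - 1)/3, so e ≥ 1/3 is more than enough.
  set u := (1 : ℝ) / (2 * n)
  have hWu : 0 ≤ W * u := by positivity
  have hx0 : 0 ≤ x := by linarith
  have k1 : x * (W * u * 2) ≤ x * F₀ := mul_le_mul_of_nonneg_left hF hx0
  have k2 : x * W ≤ (e + e * u) * W := mul_le_mul_of_nonneg_right hx hW
  have k3 : e * (W * u) ≤ x * (W * u) := mul_le_mul_of_nonneg_right h1 hWu
  have k4 : 1 / 3 * (W * u) ≤ e * (W * u) := mul_le_mul_of_nonneg_right he hWu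
  nlinarith

/-! ### Marginal gains and random assignments drawn from a table. -/

/-- Change one entry of a table. -/
def tableSet (h : ℕ → ℕ → ℕ) (i t v : ℕ) : ℕ → ℕ → ℕ :=
  fun i' t' => if i' = i ∧ t' = t then v else h i' t'

namespace Instance

variable {n m : ℕ} (I : Instance n m)

/-- Gain from assigning consumer `i` to supplier number `v - 1` instead of to nobody. -/
noncomputable def gain (ρ : Fin n → ℕ) (i : Fin n) (v : ℕ) : ℝ :=
  I.value (Function.update ρ i v) - I.value (Function.update ρ i 0)

theorem gain_eq (ρ : Fin n → ℕ) (i : Fin n) (v : ℕ) :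
    I.gain ρ i v = ∑ j : Fin m, if v = j + 1 then I.revenue j *
      ((I.supplier j).demand (insert i (univ.filter fun k => ρ k = j + 1)) -
        (I.supplier j).demand ((univ.filter fun k => ρ k = j + 1).erase i)) else 0 := by
  unfold gain value
  rw [← sum_sub_distrib]
  refine sum_congr rfl fun j _ => ?_
  have h0 : (univ.filter fun k => Function.update ρ i 0 k = j + 1) =
      (univ.filter fun k => ρ k = j + 1).erase i := by
    ext k
    by_cases hk : k = i <;> simp [hk]
  rw [h0]
  split_ifs with hv
  · have h1 : (univ.filter fun k => Function.update ρ i v k = j + 1) =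
        insert i (univ.filter fun k => ρ k = j + 1) := by
      ext k
      by_cases hk : k = i <;> simp [hk, hv]
    rw [h1, mul_sub]
  · have h1 : (univ.filter fun k => Function.update ρ i v k = j + 1) =
        (univ.filter fun k => ρ k = j + 1).erase i := by
      ext k
      by_cases hk : k = i <;> simp [hk, hv]
    rw [h1, sub_self]

theorem gain_succ (ρ : Fin n → ℕ) (i : Fin n) (j : Fin m) :
    I.gain ρ i (j + 1) = I.revenue j *
      ((I.supplier j).demand (insert i (univ.filter fun k => ρ k = j + 1)) -
        (I.supplier j).demand ((univ.filter fun k => ρ k = j + 1).erase i)) := by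
  rw [gain_eq, sum_eq_single j]
  · simp
  · intro j' _ hj
    rw [if_neg]
    intro h
    exact hj (Fin.ext (by omega))
  · simp

theorem gain_zero (ρ : Fin n → ℕ) (i : Fin n) : I.gain ρ i 0 = 0 := by
  simp [gain]

/-- Both terms of the gain overwrite the assignment of consumer i. This is what makes the mean value
affine in the distribution of each single consumer. -/
theorem gain_congr {ρ ρ' : Fin n → ℕ} {i : Fin n} (h : ∀ k, k ≠ i → ρ k = ρ' k) (v : ℕ) :
    I.gain ρ i v = I.gain ρ' i v := by
  have : ∀ v, Function.update ρ i v = Function.update ρ' i v := by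
    intro v
    ext k
    by_cases hk : k = i
    · simp [hk]
    · simp [hk, h k hk]
  simp [gain, this]

variable (hq : ∀ j, IsCoverage (I.supplier j).demand)

include hq

theorem value_nonneg (ρ : Fin n → ℕ) : 0 ≤ I.value ρ :=
  sum_nonneg fun j _ => mul_nonneg (I.revenue_nonneg j) ((hq j).nonneg _)

theorem value_zero : I.value (fun _ => 0) = 0 := by
  unfold value
  refine sum_eq_zero fun j _ => ?_
  have : (univ.filter fun _ : Fin n => 0 = (j : ℕ) + 1) = ∅ := by simp
  rw [this, (hq j).empty, mul_zero]

theorem gain_nonneg (ρ : Fin n → ℕ) (i : Fin n) (v : ℕ) : 0 ≤ I.gain ρ i v := by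
  rw [gain_eq]
  refine sum_nonneg fun j _ => ?_
  split_ifs
  · exact mul_nonneg (I.revenue_nonneg j) ((hq j).marginal_nonneg _ _)
  · exact le_rfl

/-- The hypothesis says that ρ' extends ρ, so every supplier holds more consumers under ρ' and
marginals shrink. -/
theorem gain_antitone {ρ ρ' : Fin n → ℕ} (h : ∀ k, ρ k = 0 ∨ ρ' k = ρ k) (i : Fin n) (v : ℕ) :
    I.gain ρ' i v ≤ I.gain ρ i v := by
  rw [gain_eq, gain_eq]
  refine sum_le_sum fun j _ => ?_
  split_ifs
  · refine mul_le_mul_of_nonneg_left ((hq j).marginal_antitone ?_ _) (I.revenue_nonneg j)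
    intro k hk
    simp only [mem_filter, mem_univ, true_and] at hk ⊢
    have := h k
    omega
  · exact le_rfl

theorem gain_le_value (ρ : Fin n → ℕ) (i : Fin n) (v : ℕ) :
    I.gain ρ i v ≤ I.value (Function.update (fun _ => 0) i v) :=
  (I.gain_antitone hq (ρ := fun _ => 0) (fun _ => Or.inl rfl) i v).trans
    (sub_le_self _ (I.value_nonneg hq _))

/-- Submodularity at each supplier, summed over suppliers. Only consumers moved by o contribute, and
S contains all of them; leaving out a consumer on which o and ρ agree is what later spares the pair
fixed at the start. -/
theorem value_le_add_sum_gain (ρ o : Fin n → ℕ) (S : Finset (Fin n))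
    (hS : ∀ k, k ∉ S → o k = ρ k) :
    I.value o ≤ I.value ρ + ∑ k ∈ S, I.gain ρ k (o k) := by
  simp_rw [gain_eq]
  rw [sum_comm]
  unfold value
  rw [← sum_add_distrib]
  refine sum_le_sum fun j _ => ?_
  have h := mul_le_mul_of_nonneg_left ((hq j).le_add_sum_marginals
    (univ.filter fun k => ρ k = j + 1) (univ.filter fun k => o k = j + 1)) (I.revenue_nonneg j)
  refine h.trans ?_
  rw [mul_add, mul_sum, ← sum_filter]
  refine add_le_add le_rfl ?_
  refine sum_le_sum_of_subset_of_nonneg ?_ fun k _ _ =>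
    mul_nonneg (I.revenue_nonneg j) ((hq j).marginal_nonneg _ _)
  intro k hk
  simp only [mem_sdiff, mem_filter, mem_univ, true_and] at hk ⊢
  refine ⟨by_contra fun hkS => hk.2 ?_, hk.1⟩
  rw [← hS k hkS, hk.1]

/-- The gains of the n pairs of o over the empty assignment add up to at least the value of o, so
one pair carries an nth part. -/
theorem exists_single_value_ge (hn : 0 < n) (o : Fin n → ℕ) :
    ∃ i, I.value o / n ≤ I.value (Function.update (fun _ => 0) i (o i)) := by
  by_contra! hcon
  have h := I.value_le_add_sum_gain hq (fun _ => 0) o univ (by simp)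
  rw [I.value_zero hq, zero_add] at h
  have hne : (univ : Finset (Fin n)).Nonempty := ⟨⟨0, hn⟩, mem_univ _⟩
  have h2 : ∑ k, I.gain (fun _ => 0) k (o k) < ∑ _k : Fin n, I.value o / n :=
    sum_lt_sum_of_nonempty hne fun k _ => (I.gain_le_value hq _ _ _).trans_lt (hcon k)
  rw [sum_const, card_univ, Fintype.card_fin, nsmul_eq_mul, mul_div_cancel₀] at h2
  · linarith
  · exact_mod_cast hn.ne'

omit hq

/-- Expected value when every consumer `k` is assigned according to an independent uniformly random
entry of row `k` of the table `h`. -/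
noncomputable def mix (T : ℕ) (h : ℕ → ℕ → ℕ) : ℝ :=
  𝔼 σ : Fin n → Fin T, I.value fun k => h k (σ k)

/-- Expected gain from assigning consumer `i` to supplier number `v - 1`. -/
noncomputable def mixGain (T : ℕ) (h : ℕ → ℕ → ℕ) (i : Fin n) (v : ℕ) : ℝ :=
  𝔼 σ : Fin n → Fin T, I.gain (fun k => h k (σ k)) i v

theorem mixGain_zero (T : ℕ) (h : ℕ → ℕ → ℕ) (i : Fin n) : I.mixGain T h i 0 = 0 := by
  simp [mixGain, gain_zero]

theorem mixGain_tableSet_self (T : ℕ) (h : ℕ → ℕ → ℕ) (i : Fin n) (t v w : ℕ) :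
    I.mixGain T (tableSet h i t v) i w = I.mixGain T h i w := by
  unfold mixGain
  refine expect_congr rfl fun σ _ => I.gain_congr (fun k hk => ?_) w
  simp [tableSet, Fin.val_inj, hk]

/-- The new entry matters only if consumer i draws column t, which has probability 1/T. The gain
does not depend on the draw of i, so conditioning on this event leaves its mean unchanged;
resampling coordinate i makes the independence explicit. -/
theorem mix_tableSet {T : ℕ} {h : ℕ → ℕ → ℕ} {i : Fin n} {t : ℕ} (ht : t < T) (h0 : h i t = 0)
    (v : ℕ) : I.mix T (tableSet h i t v) = I.mix T h + I.mixGain T h i v / T := by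
  have : Nonempty (Fin T) := ⟨⟨t, ht⟩⟩
  have h1 : ∀ σ : Fin n → Fin T, I.value (fun k : Fin n => tableSet h i t v k (σ k)) =
      I.value (fun k => h k (σ k)) +
        if σ i = ⟨t, ht⟩ then I.gain (fun k => h k (σ k)) i v else 0 := by
    intro σ
    split_ifs with hσ
    · have e1 : (fun k : Fin n => tableSet h i t v k (σ k)) =
          Function.update (fun k : Fin n => h k (σ k)) i v := by
        ext k
        by_cases hk : k = i
        · subst hk
          simp [tableSet, hσ]
        · simp [tableSet, Fin.val_inj, hk]
      have e2 : Function.update (fun k : Fin n => h k (σ k)) i 0 = fun k : Fin n => h k (σ k) := by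
        rw [Function.update_eq_self_iff, hσ, h0]
      rw [gain, e1, e2]
      ring
    · rw [add_zero]
      congr 1
      ext k
      have : ¬ (k = i ∧ ((σ k : ℕ) = t)) := by
        rintro ⟨rfl, hk⟩
        exact hσ (Fin.ext hk)
      simp [tableSet, Fin.val_inj, this]
  unfold mix mixGain
  simp_rw [h1]
  rw [expect_add_distrib]
  congr 1
  rw [← expect_expect_update i]
  have h2 : ∀ (x : Fin T) (σ : Fin n → Fin T),
      (if Function.update σ i x i = ⟨t, ht⟩ then
        I.gain (fun k => h k (Function.update σ i x k)) i v else 0) =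
      if x = ⟨t, ht⟩ then I.gain (fun k => h k (σ k)) i v else 0 := by
    intro x σ
    rw [Function.update_self, I.gain_congr (ρ' := fun k => h k (σ k)) (fun k hk => by
      simp [hk])]
  simp_rw [h2]
  have h3 : ∀ x : Fin T, 𝔼 σ : Fin n → Fin T,
      (if x = ⟨t, ht⟩ then I.gain (fun k => h k (σ k)) i v else 0) =
      if x = ⟨t, ht⟩ then 𝔼 σ : Fin n → Fin T, I.gain (fun k => h k (σ k)) i v else 0 := by
    intro x
    split_ifs <;> simp
  simp_rw [h3]
  rw [Fintype.expect_eq_sum_div_card, sum_ite_eq' univ (⟨t, ht⟩ : Fin T)]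
  simp

include hq

theorem mixGain_nonneg (T : ℕ) (h : ℕ → ℕ → ℕ) (i : Fin n) (v : ℕ) : 0 ≤ I.mixGain T h i v :=
  expect_nonneg fun _ _ => I.gain_nonneg hq _ _ _

theorem mixGain_tableSet_le {T : ℕ} {h : ℕ → ℕ → ℕ} {i : Fin n} {t : ℕ} (h0 : h i t = 0)
    (v : ℕ) (k : Fin n) (w : ℕ) : I.mixGain T (tableSet h i t v) k w ≤ I.mixGain T h k w := by
  refine expect_le_expect fun σ _ => I.gain_antitone hq (fun l => ?_) k w
  by_cases hl : (l : ℕ) = i ∧ (σ l : ℕ) = t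
  · left
    rw [hl.1, hl.2, h0]
  · right
    simp [tableSet, hl]

omit hq in
/-- Value of the table, minus the gains that the assignment `o` promises for the consumers before
consumer number `i`. -/
noncomputable def roundPotential (T : ℕ) (o : Fin n → ℕ) (i₀ i : ℕ) (h : ℕ → ℕ → ℕ) : ℝ :=
  I.mix T h - (∑ k ∈ univ.filter fun k : Fin n => (k : ℕ) < i ∧ (k : ℕ) ≠ i₀,
    I.mixGain T h k (o k)) / T

omit hq in
theorem roundPotential_zero (T : ℕ) (o : Fin n → ℕ) (i₀ : ℕ) (h : ℕ → ℕ → ℕ) :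
    I.roundPotential T o i₀ 0 h = I.mix T h := by
  simp [roundPotential]

omit hq in
theorem roundPotential_succ_of_skip (T : ℕ) {o : Fin n → ℕ} {i₀ : ℕ} {i : Fin n}
    (hi : (i : ℕ) = i₀ ∨ o i = 0) (h : ℕ → ℕ → ℕ) :
    I.roundPotential T o i₀ (i + 1) h = I.roundPotential T o i₀ i h := by
  unfold roundPotential
  congr 2
  symm
  refine sum_subset (fun k hk => ?_) fun k hk hk' => ?_
  · simp only [mem_filter, mem_univ, true_and] at hk ⊢
    omega
  · simp only [mem_filter, mem_univ, true_and] at hk hk'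
    have : k = i := Fin.ext (by omega)
    subst this
    rw [hi.resolve_left hk.2, mixGain_zero]

/-- The new entry raises `mix` by its own gain over T. The gain promised to i is not affected by an
entry of i, and the gains promised to earlier consumers can only shrink, which raises the potential.
-/
theorem roundPotential_succ {T : ℕ} {o : Fin n → ℕ} {i₀ : ℕ} {i : Fin n} (hi : (i : ℕ) ≠ i₀)
    {h : ℕ → ℕ → ℕ} {t : ℕ} (ht : t < T) (h0 : h i t = 0) (v : ℕ) :
    I.roundPotential T o i₀ i h + (I.mixGain T h i v - I.mixGain T h i (o i)) / T ≤
      I.roundPotential T o i₀ (i + 1) (tableSet h i t v) := by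
  unfold roundPotential
  have h1 : (univ.filter fun k : Fin n => (k : ℕ) < i + 1 ∧ (k : ℕ) ≠ i₀) =
      insert i (univ.filter fun k : Fin n => (k : ℕ) < i ∧ (k : ℕ) ≠ i₀) := by
    ext k
    simp only [mem_filter, mem_univ, true_and, mem_insert, Fin.ext_iff]
    omega
  rw [h1, sum_insert (by simp), I.mix_tableSet ht h0, mixGain_tableSet_self]
  have h2 : ∑ k ∈ univ.filter (fun k : Fin n => (k : ℕ) < i ∧ (k : ℕ) ≠ i₀),
      I.mixGain T (tableSet h i t v) k (o k) ≤
      ∑ k ∈ univ.filter (fun k : Fin n => (k : ℕ) < i ∧ (k : ℕ) ≠ i₀), I.mixGain T h k (o k) :=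
    sum_le_sum fun k _ => I.mixGain_tableSet_le hq h0 v k _
  have h3 := div_le_div_of_nonneg_right h2 (Nat.cast_nonneg (α := ℝ) T)
  rw [add_div, sub_div]
  linarith

/-- At the end of a column all promised gains are measured in the final table, where submodularity
makes them cover the gap between the value of o and `mix`. Consumer i₀ promises nothing because its
row already agrees with o. -/
theorem roundPotential_le {T : ℕ} (hT : 0 < T) {o : Fin n → ℕ} (i₀ : Fin n) {h : ℕ → ℕ → ℕ}
    (hi₀ : ∀ t < T, h i₀ t = o i₀) :
    I.roundPotential T o i₀ n h ≤ (1 + 1 / T) * I.mix T h - I.value o / T := by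
  have : Nonempty (Fin T) := ⟨⟨0, hT⟩⟩
  have h1 : I.value o ≤ I.mix T h + ∑ k ∈ univ.filter (fun k : Fin n => (k : ℕ) < n ∧ (k : ℕ) ≠ i₀),
      I.mixGain T h k (o k) := by
    unfold mix mixGain
    rw [← expect_sum_comm, ← expect_add_distrib]
    refine le_expect univ_nonempty fun σ _ => I.value_le_add_sum_gain hq _ _ _ fun k hk => ?_
    have : k = i₀ := by
      simp only [mem_filter, mem_univ, true_and, Fin.is_lt, ne_eq, not_not] at hk
      exact Fin.ext hk
    subst this
    exact (hi₀ _ (σ k).2).symm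
  have h2 := div_le_div_of_nonneg_right h1 (Nat.cast_nonneg (α := ℝ) T)
  rw [add_div] at h2
  unfold roundPotential
  have : (1 + 1 / (T : ℝ)) * I.mix T h = I.mix T h + I.mix T h / T := by ring
  linarith

omit hq in
theorem mix_of_const {T : ℕ} (hT : 0 < T) {h : ℕ → ℕ → ℕ} {ρ : Fin n → ℕ}
    (hh : ∀ (i : Fin n), ∀ t < T, h i t = ρ i) : I.mix T h = I.value ρ := by
  have : Nonempty (Fin T) := ⟨⟨0, hT⟩⟩
  unfold mix
  have : ∀ σ : Fin n → Fin T, (fun k : Fin n => h k (σ k)) = ρ := fun σ =>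
    funext fun k => hh k _ (σ k).2
  simp [this]

end Instance

end Assortment

/-! ### Finite coin-tossing trees as semantics of programs. -/

namespace Assortment

/-- Finite computations with fair coin tosses. -/
inductive Coin (α : Type) where
  | ret (a : α)
  | toss (t f : Coin α)

namespace Coin

variable {α β : Type}

/-- Sequential composition. -/
def bind : Coin α → (α → Coin β) → Coin β
  | ret a, k => k a
  | toss t f, k => toss (t.bind k) (f.bind k)

/-- Expected value of a function of the result. -/
noncomputable def E : Coin α → (α → ℝ) → ℝ
  | ret a, φ => φ a
  | toss t f, φ => (t.E φ + f.E φ) / 2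

/-- Every possible result satisfies `p`. -/
def All (p : α → Prop) : Coin α → Prop
  | ret a => p a
  | toss t f => t.All p ∧ f.All p

/-- The distribution of the result. -/
noncomputable def toPMF : Coin α → PMF α
  | ret a => PMF.pure a
  | toss t f => (PMF.uniformOfFintype Bool).bind fun b => cond b t.toPMF f.toPMF

theorem E_bind (t : Coin α) (k : α → Coin β) (φ : β → ℝ) :
    (t.bind k).E φ = t.E fun a => (k a).E φ := by
  induction t with
  | ret a => rfl
  | toss t f ht hf => simp [bind, E, ht, hf]

theorem All.bind {p : α → Prop} {q : β → Prop} {t : Coin α} {k : α → Coin β} (ht : t.All p)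
    (hk : ∀ a, p a → (k a).All q) : (t.bind k).All q := by
  induction t with
  | ret a => exact hk a ht
  | toss t f iht ihf => exact ⟨iht ht.1, ihf ht.2⟩

theorem All.mono {p q : α → Prop} {t : Coin α} (ht : t.All p) (h : ∀ a, p a → q a) : t.All q := by
  induction t with
  | ret a => exact h a ht
  | toss t f iht ihf => exact ⟨iht ht.1, ihf ht.2⟩

theorem all_true (t : Coin α) : t.All fun _ => True := by
  induction t with
  | ret a => trivial
  | toss t f iht ihf => exact ⟨iht, ihf⟩

theorem All.and {p q : α → Prop} {t : Coin α} (hp : t.All p) (hq : t.All q) :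
    t.All fun a => p a ∧ q a := by
  induction t with
  | ret a => exact ⟨hp, hq⟩
  | toss t f iht ihf => exact ⟨iht hp.1 hq.1, ihf hp.2 hq.2⟩

theorem All.E_le_E {t : Coin α} {φ ψ : α → ℝ} (h : t.All fun a => φ a ≤ ψ a) : t.E φ ≤ t.E ψ := by
  induction t with
  | ret a => exact h
  | toss t f iht ihf =>
    have h1 := iht h.1
    have h2 := ihf h.2
    simp only [E]
    linarith

theorem E_const (t : Coin α) (c : ℝ) : (t.E fun _ => c) = c := by
  induction t with
  | ret a => rfl
  | toss t f iht ihf =>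
    simp only [E, iht, ihf]
    ring

theorem E_add (t : Coin α) (φ ψ : α → ℝ) : (t.E fun a => φ a + ψ a) = t.E φ + t.E ψ := by
  induction t with
  | ret a => rfl
  | toss t f iht ihf =>
    simp only [E, iht, ihf]
    ring

theorem E_mul (t : Coin α) (c : ℝ) (φ : α → ℝ) : (t.E fun a => c * φ a) = c * t.E φ := by
  induction t with
  | ret a => rfl
  | toss t f iht ihf =>
    simp only [E, iht, ihf]
    ring

theorem All.le_E {t : Coin α} {c : ℝ} {φ : α → ℝ} (h : t.All fun a => c ≤ φ a) : c ≤ t.E φ := by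
  have := h.E_le_E
  rwa [E_const] at this

theorem All.of_mem_support {p : α → Prop} {t : Coin α} (ht : t.All p) {a : α}
    (ha : a ∈ t.toPMF.support) : p a := by
  induction t with
  | ret b =>
    rw [toPMF, PMF.support_pure] at ha
    exact (Set.mem_singleton_iff.1 ha) ▸ ht
  | toss t f iht ihf =>
    rw [toPMF, PMF.mem_support_bind_iff] at ha
    obtain ⟨b, -, hb⟩ := ha
    cases b
    · exact ihf ht.2 hb
    · exact iht ht.1 hb

theorem toPMF_bind (t : Coin α) (k : α → Coin β) :
    (t.bind k).toPMF = t.toPMF.bind fun a => (k a).toPMF := by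
  induction t with
  | ret a => simp [bind, toPMF]
  | toss t f iht ihf =>
    simp only [bind, toPMF, iht, ihf, PMF.bind_bind]
    congr 1
    ext1 b
    cases b <;> rfl

theorem sum_toPMF_map {γ : Type} [Fintype γ] (t : Coin α) (g : α → γ) (φ : γ → ℝ) :
    ∑ c, ((t.toPMF.map g) c).toReal * φ c = t.E fun a => φ (g a) := by
  classical
  induction t with
  | ret a =>
    simp only [toPMF, PMF.pure_map, E, PMF.pure_apply]
    rw [Finset.sum_eq_single (g a)] <;> simp +contextual
  | toss t f iht ihf =>
    have h : ∀ c, (((toss t f).toPMF.map g) c).toReal =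
        ((t.toPMF.map g c).toReal + (f.toPMF.map g c).toReal) / 2 := by
      intro c
      rw [toPMF, PMF.map_bind, PMF.bind_apply, tsum_fintype]
      simp only [PMF.uniformOfFintype_apply, Fintype.sum_bool, cond_true, cond_false]
      have h1 : ∀ u : PMF α, ((Fintype.card Bool : ENNReal))⁻¹ * u.map g c ≠ ⊤ := fun u =>
        ENNReal.mul_ne_top (by simp) (PMF.apply_ne_top _ _)
      rw [ENNReal.toReal_add (h1 _) (h1 _)]
      simp only [ENNReal.toReal_mul, Fintype.card_bool]
      norm_num
      ring
    simp only [h, E, ← iht, ← ihf, ← Finset.sum_add_distrib, Finset.sum_div]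
    exact Finset.sum_congr rfl fun c _ => by ring

/-- `rounds f k` runs `f 0`, `f 1`, ..., `f (k - 1)` one after the other. -/
def rounds (f : ℕ → α → Coin α) : ℕ → α → Coin α
  | 0, a => ret a
  | k + 1, a => (rounds f k a).bind (f k)

theorem all_rounds {f : ℕ → α → Coin α} {N : ℕ} (Inv : ℕ → α → Prop) {a : α} (h0 : Inv 0 a)
    (h : ∀ k < N, ∀ b, Inv k b → (f k b).All (Inv (k + 1))) : (rounds f N a).All (Inv N) := by
  induction N with
  | zero => exact h0
  | succ N ih => exact (ih fun k hk => h k (hk.trans N.lt_succ_self)).bind (h N N.lt_succ_self)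

/-- The submartingale principle: a potential that does not drop in mean in any round does not drop
in mean over all rounds. -/
theorem le_E_rounds {f : ℕ → α → Coin α} {N : ℕ} (Inv : ℕ → α → Prop) (Φ : ℕ → α → ℝ) {a : α}
    (h0 : Inv 0 a) (h : ∀ k < N, ∀ b, Inv k b → (f k b).All (Inv (k + 1)))
    (hΦ : ∀ k < N, ∀ b, Inv k b → Φ k b ≤ (f k b).E (Φ (k + 1))) :
    Φ 0 a ≤ (rounds f N a).E (Φ N) := by
  induction N with
  | zero => exact le_rfl
  | succ N ih =>
    rw [rounds, E_bind]
    refine (ih (fun k hk => h k (hk.trans N.lt_succ_self))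
      (fun k hk => hΦ k (hk.trans N.lt_succ_self))).trans ?_
    exact ((all_rounds Inv h0 fun k hk => h k (hk.trans N.lt_succ_self)).mono
      (hΦ N N.lt_succ_self)).E_le_E

end Coin

open Classical in
/-- The computation tree of a program. -/
noncomputable def Program.tree (Q : Oracle) : Program → Memory → Coin Memory
  | .skip, s => .ret (s.tick 1)
  | .setNat a i j e, s =>
      .ret ((s.writeNat a (i.eval s) (j.eval s) (e.eval s)).tick
        (i.cost + j.cost + e.cost + 1))
  | .setReal a i j e, s =>
      .ret ((s.writeReal a (i.eval s) (j.eval s) (e.eval s)).tick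
        (i.cost + j.cost + e.cost + 1))
  | .flip a i j, s =>
      .toss (.ret ((s.writeNat a (i.eval s) (j.eval s) 1).tick (i.cost + j.cost + 1)))
        (.ret ((s.writeNat a (i.eval s) (j.eval s) 0).tick (i.cost + j.cost + 1)))
  | .query a i j e b row, s =>
      .ret ((s.writeReal a (i.eval s) (j.eval s)
        (Q (e.eval s) {k | s.nat b (row.eval s) k ≠ 0})).tick
          (i.cost + j.cost + e.cost + row.cost + 1))
  | .seq p q, s => (p.tree Q s).bind (q.tree Q)
  | .ite t p q, s =>
      if t.Holds s then p.tree Q (s.tick (t.cost + 1)) else q.tree Q (s.tick (t.cost + 1))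
  | .loop x e p, s =>
      Coin.rounds (fun k s' => p.tree Q ((s'.writeNat x 0 0 k).tick 1)) (e.eval s)
        (s.tick (e.cost + 1))

namespace Program

theorem toPMF_rounds {f : ℕ → Memory → Coin Memory} {g : ℕ → Memory → PMF Memory}
    (h : ∀ k s, g k s = (f k s).toPMF) (N : ℕ) (s : Memory) :
    rounds g N s = (Coin.rounds f N s).toPMF := by
  induction N with
  | zero => rfl
  | succ N ih =>
    rw [rounds, Coin.rounds, Coin.toPMF_bind, ih]
    congr 1
    ext1 s'
    exact h N s'

/-- Replaces distributions on the uncountable type of memories by finite trees, on which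
expectations of real functions are plain averages. -/
theorem run_eq_toPMF (Q : Oracle) (P : Program) (s : Memory) :
    P.run Q s = (P.tree Q s).toPMF := by
  induction P generalizing s with
  | skip | setNat | setReal | query => rfl
  | flip a i j =>
    simp only [run, tree, Coin.toPMF, PMF.map]
    congr 1
    ext1 b
    cases b <;> rfl
  | seq p q hp hq =>
    rw [run, tree, Coin.toPMF_bind, hp]
    congr 1
    ext1 s'
    exact hq s'
  | ite t p q hp hq =>
    rw [run, tree]
    split_ifs
    · exact hp _
    · exact hq _
  | loop x e p hp =>
    rw [run, tree]
    exact toPMF_rounds (fun k s' => hp _) _ _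

/-- The program does not write the natural number array `a`. -/
def keepsNat (a : ℕ) : Program → Bool
  | setNat b _ _ _ => b != a
  | flip b _ _ => b != a
  | seq p q => p.keepsNat a && q.keepsNat a
  | ite _ p q => p.keepsNat a && q.keepsNat a
  | loop x _ p => x != a && p.keepsNat a
  | _ => true

/-- The program does not write the real array `a`. -/
def keepsReal (a : ℕ) : Program → Bool
  | setReal b _ _ _ => b != a
  | query b _ _ _ _ _ => b != a
  | seq p q => p.keepsReal a && q.keepsReal a
  | ite _ p q => p.keepsReal a && q.keepsReal a
  | loop _ _ p => p.keepsReal a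
  | _ => true

end Program

namespace Memory

@[simp] theorem tick_nat (s : Memory) (k : ℕ) : (s.tick k).nat = s.nat := rfl
@[simp] theorem tick_real (s : Memory) (k : ℕ) : (s.tick k).real = s.real := rfl
@[simp] theorem tick_clock (s : Memory) (k : ℕ) : (s.tick k).clock = s.clock + k := rfl
@[simp] theorem writeNat_real (s : Memory) (a i j v : ℕ) : (s.writeNat a i j v).real = s.real := rfl
@[simp] theorem writeNat_clock (s : Memory) (a i j v : ℕ) :
    (s.writeNat a i j v).clock = s.clock := rfl
@[simp] theorem writeReal_nat (s : Memory) (a i j : ℕ) (v : ℝ) :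
    (s.writeReal a i j v).nat = s.nat := rfl
@[simp] theorem writeReal_clock (s : Memory) (a i j : ℕ) (v : ℝ) :
    (s.writeReal a i j v).clock = s.clock := rfl

@[simp] theorem writeNat_nat (s : Memory) (a i j v a' i' j' : ℕ) :
    (s.writeNat a i j v).nat a' i' j' = if a' = a ∧ i' = i ∧ j' = j then v else s.nat a' i' j' :=
  rfl

@[simp] theorem writeReal_real (s : Memory) (a i j : ℕ) (v : ℝ) (a' i' j' : ℕ) :
    (s.writeReal a i j v).real a' i' j' = if a' = a ∧ i' = i ∧ j' = j then v else s.real a' i' j' :=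
  rfl

theorem writeNat_nat_ne (s : Memory) {a a' : ℕ} (h : a' ≠ a) (i j v : ℕ) :
    (s.writeNat a i j v).nat a' = s.nat a' := by
  ext i' j'
  simp [h]

theorem writeReal_real_ne (s : Memory) {a a' : ℕ} (h : a' ≠ a) (i j : ℕ) (v : ℝ) :
    (s.writeReal a i j v).real a' = s.real a' := by
  ext i' j'
  simp [h]

end Memory

namespace Program

variable {Q : Oracle}

/-- A frame rule decided by computation: for a concrete program and array, `rfl` proves that the
array is left untouched. -/
theorem all_frame (P : Program) (s : Memory) :
    (P.tree Q s).All fun s' => (∀ a, P.keepsNat a = true → s'.nat a = s.nat a) ∧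
      ∀ a, P.keepsReal a = true → s'.real a = s.real a := by
  induction P generalizing s with
  | skip => exact ⟨fun _ _ => rfl, fun _ _ => rfl⟩
  | setNat b i j e =>
    exact ⟨fun a h => s.writeNat_nat_ne (bne_iff_ne.1 h).symm _ _ _, fun _ _ => rfl⟩
  | flip b i j =>
    exact ⟨⟨fun a h => s.writeNat_nat_ne (bne_iff_ne.1 h).symm _ _ _, fun _ _ => rfl⟩,
      ⟨fun a h => s.writeNat_nat_ne (bne_iff_ne.1 h).symm _ _ _, fun _ _ => rfl⟩⟩
  | setReal b i j e =>
    exact ⟨fun _ _ => rfl, fun a h => s.writeReal_real_ne (bne_iff_ne.1 h).symm _ _ _⟩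
  | query b i j e c r =>
    exact ⟨fun _ _ => rfl, fun a h => s.writeReal_real_ne (bne_iff_ne.1 h).symm _ _ _⟩
  | seq p q hp hq =>
    simp only [keepsNat, keepsReal, Bool.and_eq_true]
    exact (hp s).bind fun s' hs' => (hq s').mono fun s'' h'' =>
      ⟨fun a h => (h''.1 a h.2).trans (hs'.1 a h.1), fun a h => (h''.2 a h.2).trans (hs'.2 a h.1)⟩
  | ite t p q hp hq =>
    simp only [keepsNat, keepsReal, Bool.and_eq_true]
    rw [tree]
    split_ifs
    · exact (hp _).mono fun s' h' => ⟨fun a h => h'.1 a h.1, fun a h => h'.2 a h.1⟩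
    · exact (hq _).mono fun s' h' => ⟨fun a h => h'.1 a h.2, fun a h => h'.2 a h.2⟩
  | loop x e p hp =>
    simp only [keepsNat, keepsReal, Bool.and_eq_true]
    rw [tree]
    refine Coin.all_rounds (fun _ (s' : Memory) => (∀ a, (x != a) = true ∧ p.keepsNat a = true →
      s'.nat a = s.nat a) ∧ ∀ a, p.keepsReal a = true → s'.real a = s.real a)
      ⟨fun _ _ => rfl, fun _ _ => rfl⟩ fun k _ s' hs' => ?_
    refine (hp _).mono fun s'' h'' => ⟨fun a h => (h''.1 a h.2).trans (Eq.trans ?_ (hs'.1 a h)),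
      fun a h => (h''.2 a h).trans (hs'.2 a h)⟩
    exact s'.writeNat_nat_ne (bne_iff_ne.1 h.1).symm _ _ _

end Program

/-! ### Running time. -/

/-- A bound on the value of an expression, from bounds on the entries of the arrays. -/
noncomputable def NatExpr.bound (β : ℕ → Polynomial ℕ) : NatExpr → Polynomial ℕ
  | .const k => Polynomial.C k
  | .get a _ _ => β a
  | .add e f => e.bound β + f.bound β
  | .sub e _ => e.bound β

/-- The bound on the value of the expression depends on the arrays in `F` only. -/
def NatExpr.dependsOn (F : List ℕ) : NatExpr → Bool
  | .const _ => true
  | .get a _ _ => F.contains a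
  | .add e f => e.dependsOn F && f.dependsOn F
  | .sub e _ => e.dependsOn F

theorem NatExpr.eval_le {β : ℕ → Polynomial ℕ} {F : List ℕ} {x : ℕ} {s : Memory} {e : NatExpr}
    (he : e.dependsOn F = true) (hβ : ∀ a ∈ F, ∀ i j, s.nat a i j ≤ (β a).eval x) :
    e.eval s ≤ (e.bound β).eval x := by
  induction e with
  | const k => simp [eval, bound]
  | get a i j => exact hβ a (by simpa [dependsOn] using he) _ _
  | add e f ihe ihf =>
    simp only [dependsOn, Bool.and_eq_true] at he
    simp only [eval, bound, Polynomial.eval_add]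
    exact add_le_add (ihe he.1) (ihf he.2)
  | sub e f ihe ihf => exact (Nat.sub_le _ _).trans (ihe he)

namespace Program

/-- The numbers of rounds of the loops are bounded in terms of the arrays in `F`. -/
def loopsOver (F : List ℕ) : Program → Bool
  | seq p q => p.loopsOver F && q.loopsOver F
  | ite _ p q => p.loopsOver F && q.loopsOver F
  | loop _ e p => e.dependsOn F && p.loopsOver F
  | _ => true

/-- A bound on the running time, from bounds on the entries of the arrays. -/
noncomputable def timeBound (β : ℕ → Polynomial ℕ) : Program → Polynomial ℕ
  | skip => 1
  | setNat _ i j e => Polynomial.C (i.cost + j.cost + e.cost + 1)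
  | setReal _ i j e => Polynomial.C (i.cost + j.cost + e.cost + 1)
  | flip _ i j => Polynomial.C (i.cost + j.cost + 1)
  | query _ i j e _ row => Polynomial.C (i.cost + j.cost + e.cost + row.cost + 1)
  | seq p q => p.timeBound β + q.timeBound β
  | ite t p q => Polynomial.C (t.cost + 1) + (p.timeBound β + q.timeBound β)
  | loop _ e p => Polynomial.C (e.cost + 1) + e.bound β * (1 + p.timeBound β)

/-- The numbers of rounds are controlled by arrays in F, which the program never writes. Bounds on
their entries at the start thus remain valid at every loop, and the cost follows from the syntax. -/
theorem all_clock_le {Q : Oracle} {β : ℕ → Polynomial ℕ} {F : List ℕ} {x : ℕ} {P : Program}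
    (hF : ∀ a ∈ F, P.keepsNat a = true) (hP : P.loopsOver F = true) {s : Memory}
    (hβ : ∀ a ∈ F, ∀ i j, s.nat a i j ≤ (β a).eval x) :
    (P.tree Q s).All fun s' => s'.clock ≤ s.clock + (P.timeBound β).eval x := by
  induction P generalizing s with
  | skip | setNat | setReal | query => simp [tree, Coin.All, timeBound]
  | flip => simp [tree, Coin.All, timeBound]
  | seq p q hp hq =>
    simp only [keepsNat, Bool.and_eq_true] at hF
    simp only [loopsOver, Bool.and_eq_true] at hP
    refine ((hp (fun a h => (hF a h).1) hP.1 hβ).and (all_frame p s)).bind fun s' hs' => ?_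
    refine (hq (fun a h => (hF a h).2) hP.2 (s := s') fun a h i j => ?_).mono fun s'' h'' => ?_
    · rw [hs'.2.1 a (hF a h).1]
      exact hβ a h i j
    · simp only [timeBound, Polynomial.eval_add]
      linarith [hs'.1]
  | ite t p q hp hq =>
    simp only [keepsNat, Bool.and_eq_true] at hF
    simp only [loopsOver, Bool.and_eq_true] at hP
    simp only [tree, timeBound, Polynomial.eval_add, Polynomial.eval_C]
    split_ifs
    · refine (hp (fun a h => (hF a h).1) hP.1 (s := s.tick (t.cost + 1)) hβ).mono fun s' hs' => ?_
      simp only [Memory.tick_clock] at hs'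
      omega
    · refine (hq (fun a h => (hF a h).2) hP.2 (s := s.tick (t.cost + 1)) hβ).mono fun s' hs' => ?_
      simp only [Memory.tick_clock] at hs'
      omega
  | loop x' e p hp =>
    simp only [keepsNat, Bool.and_eq_true] at hF
    simp only [loopsOver, Bool.and_eq_true] at hP
    have he := NatExpr.eval_le hP.1 hβ
    set c := (p.timeBound β).eval x with hc
    have h := Coin.all_rounds (f := fun k s' => p.tree Q ((s'.writeNat x' 0 0 k).tick 1))
      (N := e.eval s) (a := s.tick (e.cost + 1))
      (fun k s' => (∀ a ∈ F, s'.nat a = s.nat a) ∧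
        s'.clock ≤ s.clock + (e.cost + 1) + k * (1 + c)) ⟨fun _ _ => rfl, by simp⟩ (by
      intro k _ s' hs'
      have hfr : ∀ a ∈ F, ((s'.writeNat x' 0 0 k).tick 1).nat a = s.nat a := fun a h =>
        (s'.writeNat_nat_ne (bne_iff_ne.1 (hF a h).1).symm _ _ _).trans (hs'.1 a h)
      refine ((hp (fun a h => (hF a h).2) hP.2 (s := (s'.writeNat x' 0 0 k).tick 1)
        fun a h i j => ?_).and (all_frame p _)).mono fun s'' h'' => ⟨fun a h => ?_, ?_⟩
      · rw [hfr a h]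
        exact hβ a h i j
      · exact (h''.2.1 a (hF a h).2).trans (hfr a h)
      · have h1 := h''.1
        have h2 := hs'.2
        simp only [Memory.tick_clock, Memory.writeNat_clock] at h1
        rw [add_mul]
        linarith)
    refine h.mono fun s' hs' => ?_
    simp only [timeBound, Polynomial.eval_add, Polynomial.eval_C, Polynomial.eval_mul,
      Polynomial.eval_one, ← hc]
    have := Nat.mul_le_mul_right (1 + c) he
    linarith [hs'.2]

end Program

end Assortment

/-! ### The algorithm, proof rules, and random draws from the table. -/

namespace Assortment

open Finset BigOperators

/-- The natural number variable number `a`. -/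
abbrev NatExpr.var (a : ℕ) : NatExpr := .get a (.const 0) (.const 0)

/-- The real variable number `a`. -/
abbrev RealExpr.var (a : ℕ) : RealExpr := .get a (.const 0) (.const 0)

/-- `1` if the values of the expressions are equal, and `0` otherwise. -/
def NatExpr.eqInd (e f : NatExpr) : NatExpr := .sub (.const 1) (.add (.sub e f) (.sub f e))

theorem NatExpr.eval_eqInd (e f : NatExpr) (s : Memory) :
    (e.eqInd f).eval s = if e.eval s = f.eval s then 1 else 0 := by
  simp only [eqInd, eval]
  split_ifs <;> omega

/-! ### The program

Natural number arrays: `0` number of consumers, `1` number of suppliers, `2` whether there are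
budgets, `3` budgets, `4` output, `5` number `2 ^ L` of columns of the table, `6` the exponent `L`,
`7` number of samples, `8` and `9` the consumer and the supplier (counted from `0`) paired at the
start, `10` column, `11` consumer, `12` sample, `13` supplier, `14` consumer, `15` counter, `16`
random bit, `17` random column, `18` table, `19` assignment, `20` set for the oracle, `21` best
supplier, `22` auxiliary, `23` counter.

Real arrays: `0` revenues, `1` sums of sampled gains, `2` and `3` answers of the oracle, `4` value of
the current assignment, `5` value of the best assignment. -/

namespace Program

/-- Draw a uniformly random column of the table. -/
def pick : Program :=
  .seq (.setNat 17 (.const 0) (.const 0) (.const 0))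
    (.loop 15 (.var 6) (.seq (.flip 16 (.const 0) (.const 0))
      (.setNat 17 (.const 0) (.const 0) (.add (.add (.var 17) (.var 17)) (.var 16)))))

/-- Draw an assignment from the table. -/
def sample : Program :=
  .loop 14 (.var 0) (.seq pick (.setNat 19 (.const 0) (.var 14) (.get 18 (.var 14) (.var 17))))

/-- Prepare the set of consumers assigned to the current supplier. -/
def row : Program :=
  .loop 14 (.var 0) (.setNat 20 (.const 0) (.var 14)
    ((NatExpr.get 19 (.const 0) (.var 14)).eqInd (.add (.var 13) (.const 1))))

/-- Add, for every supplier, the gain from adding the current consumer to the sums. -/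
def estimate : Program :=
  .loop 13 (.var 1) (.seq row (.seq (.setNat 20 (.const 0) (.var 11) (.const 0))
    (.seq (.query 2 (.const 0) (.const 0) (.var 13) 20 (.const 0))
    (.seq (.setNat 20 (.const 0) (.var 11) (.const 1))
    (.seq (.query 3 (.const 0) (.const 0) (.var 13) 20 (.const 0))
    (.setReal 1 (.const 0) (.var 13) (.add (.get 1 (.const 0) (.var 13))
      (.mul (.get 0 (.const 0) (.var 13)) (.sub (.var 3) (.var 2))))))))))

/-- Reset the sums. -/
def clear : Program := .loop 13 (.var 1) (.setReal 1 (.const 0) (.var 13) (.const 0))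

/-- Find a supplier with the largest sum. -/
def argmax : Program :=
  .seq (.setNat 21 (.const 0) (.const 0) (.const 0))
    (.loop 13 (.var 1) (.ite
      (.realLe (.get 1 (.const 0) (.var 21)) (.get 1 (.const 0) (.var 13)))
      (.setNat 21 (.const 0) (.const 0) (.var 13)) .skip))

/-- Choose a supplier for the current consumer and enter it in the current column. -/
def choose : Program :=
  .seq clear (.seq (.loop 12 (.var 7) (.seq sample estimate))
    (.seq argmax (.setNat 18 (.var 11) (.var 10) (.add (.var 21) (.const 1)))))

/-- Whether consumer number `e` may be shown some supplier. -/
def eligible (e : NatExpr) : Test := .natLe (.var 2) (.get 3 (.const 0) e)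

/-- Treat the current entry of the table, unless its consumer is the one paired at the start. -/
def step : Program :=
  .ite (.conj (eligible (.var 11))
      (.neg (.conj (.natLe (.var 11) (.var 8)) (.natLe (.var 8) (.var 11)))))
    choose .skip

/-- Fill the table. -/
def fill : Program := .loop 10 (.var 5) (.loop 11 (.var 0) step)

/-- Empty the table, except for the pair fixed at the start. -/
def start : Program :=
  .seq (.loop 11 (.var 0) (.loop 10 (.var 5) (.setNat 18 (.var 11) (.var 10) (.const 0))))
    (.loop 10 (.var 5) (.setNat 18 (.var 8) (.var 10) (.add (.var 9) (.const 1))))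

/-- Value of the current assignment. -/
def evaluate : Program :=
  .seq (.setReal 4 (.const 0) (.const 0) (.const 0))
    (.loop 13 (.var 1) (.seq row (.seq (.query 2 (.const 0) (.const 0) (.var 13) 20 (.const 0))
      (.setReal 4 (.const 0) (.const 0) (.add (.var 4)
        (.mul (.get 0 (.const 0) (.var 13)) (.var 2)))))))

/-- Write the current assignment to the output. -/
def write : Program :=
  .loop 11 (.var 0) (.loop 13 (.var 1) (.setNat 4 (.var 11) (.var 13)
    ((NatExpr.get 19 (.const 0) (.var 11)).eqInd (.add (.var 13) (.const 1)))))

/-- Keep the current assignment if it is the best one so far. -/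
def record : Program :=
  .ite (.realLe (.var 5) (.var 4))
    (.seq (.setReal 5 (.const 0) (.const 0) (.var 4)) write) .skip

/-- Try one pair to start with. -/
def attempt : Program :=
  .ite (eligible (.var 8)) (.seq start (.seq fill (.seq sample (.seq evaluate record)))) .skip

/-- Try all pairs to start with. -/
def attempts : Program := .loop 8 (.var 0) (.loop 9 (.var 1) attempt)

/-- Compute the size of the table. -/
def tableSize : Program :=
  .seq (.setNat 5 (.const 0) (.const 0) (.const 1))
    (.loop 15 (.var 0) (.ite (.natLe (.add (.var 0) (.var 0)) (.var 5)) .skip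
      (.seq (.setNat 5 (.const 0) (.const 0) (.add (.var 5) (.var 5)))
        (.setNat 6 (.const 0) (.const 0) (.add (.var 6) (.const 1))))))

/-- Compute the number of samples. -/
def sampleSize : Program :=
  .seq (.setNat 7 (.const 0) (.const 0) (.const 144))
    (.loop 15 (.const 5) (.seq (.setNat 22 (.const 0) (.const 0) (.const 0))
      (.seq (.loop 23 (.add (.var 0) (.var 1))
        (.setNat 22 (.const 0) (.const 0) (.add (.var 22) (.var 7))))
      (.setNat 7 (.const 0) (.const 0) (.var 22)))))

/-- The approximation algorithm. -/
def approximation : Program := .seq (.seq tableSize sampleSize) attempts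

variable {Q : Oracle}

/-- The memories agree on the arrays that the program does not write. -/
def Frame (P : Program) (s s' : Memory) : Prop :=
  (∀ a, P.keepsNat a = true → s'.nat a = s.nat a) ∧ ∀ a, P.keepsReal a = true → s'.real a = s.real a

theorem le_E_of_frame {P : Program} {s : Memory} {φ ψ : Memory → ℝ}
    (h : ∀ s', P.Frame s s' → ψ s' ≤ φ s') : (P.tree Q s).E ψ ≤ (P.tree Q s).E φ :=
  ((all_frame P s).mono h).E_le_E

theorem le_E_seq {p q : Program} {s : Memory} {post : Memory → Prop} {φ : Memory → ℝ} {c : ℝ}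
    (hp : (p.tree Q s).All post) (h : ∀ s', p.Frame s s' → post s' → c ≤ (q.tree Q s').E φ) :
    c ≤ ((seq p q).tree Q s).E φ := by
  rw [tree, Coin.E_bind]
  exact ((hp.and (all_frame p s)).mono fun s' hs' => h s' hs'.2 hs'.1).le_E

theorem all_seq {p q : Program} {s : Memory} {mid post : Memory → Prop}
    (hp : (p.tree Q s).All mid) (h : ∀ s', p.Frame s s' → mid s' → (q.tree Q s').All post) :
    ((seq p q).tree Q s).All post :=
  (hp.and (all_frame p s)).bind fun s' hs' => h s' hs'.2 hs'.1

/-- `b` is obtained from `s` by setting the variable `x` to `k`. -/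
def Enters (x k : ℕ) (s b : Memory) : Prop :=
  b.nat x 0 0 = k ∧ (∀ a, a ≠ x → b.nat a = s.nat a) ∧ b.real = s.real

theorem enters_writeNat (x k : ℕ) (s : Memory) : Enters x k s ((s.writeNat x 0 0 k).tick 1) :=
  ⟨by simp, fun _ ha => s.writeNat_nat_ne ha _ _ _, rfl⟩

theorem Frame.enters {x k : ℕ} {e : NatExpr} {p : Program} {s s' b : Memory}
    (h : (loop x e p).Frame s s') (hb : Enters x k s' b) : (loop x e p).Frame s b := by
  refine ⟨fun a ha => ?_, fun a ha => ?_⟩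
  · rw [hb.2.1 a ?_, h.1 a ha]
    simp only [keepsNat, Bool.and_eq_true, bne_iff_ne] at ha
    exact ha.1.symm
  · rw [hb.2.2, h.2 a ha]

theorem Frame.trans_body {x : ℕ} {e : NatExpr} {p : Program} {s b c : Memory}
    (h : (loop x e p).Frame s b) (hc : p.Frame b c) : (loop x e p).Frame s c := by
  refine ⟨fun a ha => ?_, fun a ha => ?_⟩
  · rw [hc.1 a ?_, h.1 a ha]
    simp only [keepsNat, Bool.and_eq_true] at ha
    exact ha.2
  · rw [hc.2 a ha, h.2 a ha]

/-- The frame of the whole loop is carried along with the invariant, so `Inv` need not mention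
arrays that the body leaves alone. -/
theorem all_loop {x : ℕ} {e : NatExpr} {p : Program} {s : Memory} (Inv : ℕ → Memory → Prop)
    (h0 : Inv 0 (s.tick (e.cost + 1)))
    (h : ∀ k < e.eval s, ∀ s' b, Inv k s' → Enters x k s' b → (loop x e p).Frame s b →
      (p.tree Q b).All (Inv (k + 1))) :
    ((loop x e p).tree Q s).All (Inv (e.eval s)) := by
  refine Coin.All.mono (Coin.all_rounds (fun k s' => Inv k s' ∧ (loop x e p).Frame s s')
    ⟨h0, fun _ _ => rfl, fun _ _ => rfl⟩ fun k hk s' hs' => ?_) fun s' hs' => hs'.1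
  have he := enters_writeNat x k s'
  have hf := hs'.2.enters he
  exact ((h k hk s' _ hs'.1 he hf).and (all_frame p _)).mono fun c hc =>
    ⟨hc.1, hf.trans_body hc.2⟩

theorem le_E_loop {x : ℕ} {e : NatExpr} {p : Program} {s : Memory} (Inv : ℕ → Memory → Prop)
    (Φ : ℕ → Memory → ℝ) (h0 : Inv 0 (s.tick (e.cost + 1)))
    (h : ∀ k < e.eval s, ∀ s' b, Inv k s' → Enters x k s' b → (loop x e p).Frame s b →
      (p.tree Q b).All (Inv (k + 1)))
    (hΦ : ∀ k < e.eval s, ∀ s' b, Inv k s' → Enters x k s' b → (loop x e p).Frame s b →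
      Φ k s' ≤ (p.tree Q b).E (Φ (k + 1))) :
    Φ 0 (s.tick (e.cost + 1)) ≤ ((loop x e p).tree Q s).E (Φ (e.eval s)) := by
  refine Coin.le_E_rounds (fun k s' => Inv k s' ∧ (loop x e p).Frame s s') Φ
    ⟨h0, fun _ _ => rfl, fun _ _ => rfl⟩ (fun k hk s' hs' => ?_) fun k hk s' hs' => ?_
  · have he := enters_writeNat x k s'
    have hf := hs'.2.enters he
    exact ((h k hk s' _ hs'.1 he hf).and (all_frame p _)).mono fun c hc =>
      ⟨hc.1, hf.trans_body hc.2⟩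
  · have he := enters_writeNat x k s'
    exact hΦ k hk s' _ hs'.1 he (hs'.2.enters he)

theorem all_pick (s : Memory) : (pick.tree Q s).All fun s' => s'.nat 17 0 0 < 2 ^ s.nat 6 0 0 := by
  refine all_seq (mid := fun s' => s'.nat 17 0 0 = 0) (by simp [tree, Coin.All, NatExpr.eval])
    fun s1 hf h0 => ?_
  rw [← hf.1 6 rfl]
  refine all_loop (s := s1) (e := .var 6) (fun k s' => s'.nat 17 0 0 < 2 ^ k) (by simp [h0]) fun k _ s' b hs' hb _ => ?_
  rw [← hb.2.1 17 (by decide)] at hs'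
  constructor <;> simp [Coin.bind, Coin.All, tree, NatExpr.eval, pow_succ] <;> omega

/-- After k tosses array 17 holds the k leading bits of the draw, and the potential is the mean of ψ
over the numbers with these leading bits; one toss splits such a block into halves. Because the
number of columns is a power of two, fair bits give an exactly uniform draw. -/
theorem le_E_pick {s : Memory} {φ : Memory → ℝ} (ψ : ℕ → ℝ)
    (h : ∀ s', pick.Frame s s' → s'.nat 17 0 0 < 2 ^ s.nat 6 0 0 → ψ (s'.nat 17 0 0) ≤ φ s') :
    𝔼 x : Fin (2 ^ s.nat 6 0 0), ψ x ≤ (pick.tree Q s).E φ := by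
  refine le_trans ?_ (((all_frame pick s).and (all_pick s)).mono
    fun s' hs' => h s' hs'.1 hs'.2).E_le_E
  have key : ∀ (D : ℕ) (f : ℕ → ℝ), (∑ y ∈ range (2 * D), f y) / ((2 * D : ℕ) : ℝ) =
      ((∑ y ∈ range D, f (D + y)) / (D : ℝ) + (∑ y ∈ range D, f y) / (D : ℝ)) / 2 := by
    intro D f
    rw [two_mul, sum_range_add]
    rcases eq_or_ne D 0 with rfl | hD
    · simp
    · push_cast
      field_simp
      ring
  have h1 : 𝔼 x : Fin (2 ^ s.nat 6 0 0), ψ x =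
      (∑ y ∈ range (2 ^ s.nat 6 0 0), ψ y) / ((2 ^ s.nat 6 0 0 : ℕ) : ℝ) := by
    rw [Fintype.expect_eq_sum_div_card, Fintype.card_fin, Fin.sum_univ_eq_sum_range]
  rw [h1]
  refine le_E_seq (post := fun s' => s'.nat 17 0 0 = 0) (by simp [tree, Coin.All, NatExpr.eval])
    fun s1 hf h0 => ?_
  rw [← hf.1 6 rfl]
  set L := s1.nat 6 0 0 with hL
  have := le_E_loop (Q := Q) (x := 15) (e := .var 6) (p := .seq (.flip 16 (.const 0) (.const 0))
      (.setNat 17 (.const 0) (.const 0) (.add (.add (.var 17) (.var 17)) (.var 16)))) (s := s1)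
    (fun _ _ => True)
    (fun k s' => (∑ y ∈ range (2 ^ (L - k)), ψ (2 ^ (L - k) * s'.nat 17 0 0 + y)) /
      ((2 ^ (L - k) : ℕ) : ℝ)) trivial (fun k _ s' b _ _ _ => ⟨trivial, trivial⟩) (by
      intro k hk s' b _ hb _
      simp only [NatExpr.eval, ← hL] at hk
      have hLk : L - k = (L - (k + 1)) + 1 := by omega
      rw [hLk, pow_succ', ← hb.2.1 17 (by decide)]
      set D := 2 ^ (L - (k + 1))
      rw [key D fun y => ψ (2 * D * b.nat 17 0 0 + y)]
      have e1 : ∀ y, 2 * D * b.nat 17 0 0 + (D + y) =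
        D * (b.nat 17 0 0 + b.nat 17 0 0 + 1) + y := fun y => by ring
      have e2 : ∀ y, 2 * D * b.nat 17 0 0 + y = D * (b.nat 17 0 0 + b.nat 17 0 0) + y :=
        fun y => by ring
      simp [tree, Coin.bind, Coin.E, NatExpr.eval, e1, e2])
  simpa [NatExpr.eval, ← hL, h0] using this

theorem all_sample (s : Memory) : (sample.tree Q s).All fun s' => ∀ k < s.nat 0 0 0,
    ∃ t < 2 ^ s.nat 6 0 0, s'.nat 19 0 k = s.nat 18 k t := by
  refine all_loop (s := s) (e := .var 0) (fun k s' => ∀ i < k, ∃ t < 2 ^ s.nat 6 0 0, s'.nat 19 0 i = s.nat 18 i t)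
    (by simp) fun k hk s' b hs' hb hf => ?_
  refine all_seq (all_pick b) fun c hc h17 => ?_
  simp only [tree, Coin.All, NatExpr.eval, Memory.tick_nat, Memory.writeNat_nat]
  rw [hf.1 6 rfl] at h17
  intro i hi
  rw [hc.1 14 rfl, hc.1 18 rfl, hc.1 19 rfl, hb.1, hf.1 18 rfl, hb.2.1 19 (by decide)]
  by_cases hik : i = k
  · exact ⟨_, h17, by simp [hik]⟩
  · simpa [hik] using hs' i (by omega)

/-- A hybrid argument: after k rounds the first k coordinates are read from memory and the others
are still averaged. Resampling coordinate k in the average matches it with the next draw. -/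
theorem le_E_sample {n : ℕ} {s : Memory} (hn : s.nat 0 0 0 = n) {φ : Memory → ℝ}
    (ψ : (Fin n → ℕ) → ℝ)
    (h : ∀ s', sample.Frame s s' →
      (∀ k < n, ∃ t < 2 ^ s.nat 6 0 0, s'.nat 19 0 k = s.nat 18 k t) →
      ψ (fun k => s'.nat 19 0 k) ≤ φ s') :
    𝔼 σ : Fin n → Fin (2 ^ s.nat 6 0 0), ψ (fun k => s.nat 18 k (σ k)) ≤ (sample.tree Q s).E φ := by
  refine le_trans ?_ (((all_frame sample s).and (all_sample s)).mono
    fun s' hs' => h s' hs'.1 (hn ▸ hs'.2)).E_le_E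
  have := le_E_loop (Q := Q) (x := 14) (e := .var 0)
    (p := .seq pick (.setNat 19 (.const 0) (.var 14) (.get 18 (.var 14) (.var 17)))) (s := s)
    (fun _ _ => True)
    (fun k s' => 𝔼 σ : Fin n → Fin (2 ^ s.nat 6 0 0), ψ (fun i => if (i : ℕ) < k then s'.nat 19 0 i
      else s.nat 18 i (σ i)))
    trivial (fun k _ s' b _ _ _ => Coin.all_true _) (by
      intro k hk s' b _ hb hf
      simp only [NatExpr.eval, hn] at hk
      rw [tree, Coin.E_bind]
      rw [← expect_expect_update ⟨k, hk⟩]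
      have h2 := le_E_pick (Q := Q) (s := b)
        (φ := fun c => (tree Q (.setNat 19 (.const 0) (.var 14) (.get 18 (.var 14) (.var 17))) c).E
          fun s' => 𝔼 σ : Fin n → Fin (2 ^ s.nat 6 0 0), ψ (fun i => if (i : ℕ) < k + 1 then
            s'.nat 19 0 i else s.nat 18 i (σ i)))
        (fun x => 𝔼 σ : Fin n → Fin (2 ^ s.nat 6 0 0), ψ (fun i => if (i : ℕ) < k then
            s'.nat 19 0 i else if (i : ℕ) = k then s.nat 18 k x else s.nat 18 i (σ i)))
        (by
          intro c hc _
          simp only [tree, Coin.E, NatExpr.eval, Memory.tick_nat, Memory.writeNat_nat]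
          rw [hc.1 14 rfl, hc.1 18 rfl, hc.1 19 rfl, hb.1, hf.1 18 rfl, hb.2.1 19 (by decide)]
          refine le_of_eq (expect_congr rfl fun σ _ => ?_)
          congr 1
          ext i
          rcases lt_trichotomy (i : ℕ) k with hi | hi | hi
          · simp [hi, hi.ne, hi.trans (Nat.lt_succ_self k)]
          · simp [hi]
          · simp [hi.ne', not_lt.2 hi.le, show ¬ (i : ℕ) < k + 1 by omega])
      rw [hf.1 6 rfl] at h2
      refine le_trans (le_of_eq ?_) h2
      refine expect_congr rfl fun x _ => expect_congr rfl fun σ _ => ?_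
      congr 1
      ext i
      by_cases hi : i = ⟨k, hk⟩
      · simp [hi]
      · have : (i : ℕ) ≠ k := fun h => hi (Fin.ext h)
        simp [hi, this])
  refine le_trans (le_of_eq ?_) (this.trans (le_of_eq ?_))
  · simp
  · simp only [NatExpr.eval, hn]
    congr 1
    ext s'
    simp

end Program

end Assortment

/-! ### Correctness of the deterministic subroutines. -/

namespace Assortment

open Finset BigOperators

theorem Instance.oracle_eq {n m : ℕ} (I : Instance n m) (j : Fin m) {A : Set ℕ}
    {C : Finset (Fin n)} (h : ∀ i : Fin n, (i : ℕ) ∈ A ↔ i ∈ C) :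
    I.oracle j A = (I.supplier j).demand C := by
  classical
  unfold Instance.oracle
  rw [dif_pos j.2]
  congr 1
  ext i
  simp [h]

/-- The parameters of the algorithm are in place. -/
structure Setup {n m : ℕ} (I : Instance n m) (L N : ℕ) (s : Memory) : Prop where
  consumers : s.nat 0 0 0 = n
  suppliers : s.nat 1 0 0 = m
  eligible : ∀ i : Fin n, s.nat 2 0 0 ≤ s.nat 3 0 i ↔ I.Eligible i
  columns : s.nat 5 0 0 = 2 ^ L
  exponent : s.nat 6 0 0 = L
  samples : s.nat 7 0 0 = N
  revenue : ∀ j : Fin m, s.real 0 0 j = I.revenue j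

namespace Program

/-- The program does not write the parameters of the algorithm. -/
def keepsSetup (P : Program) : Bool :=
  P.keepsNat 0 && P.keepsNat 1 && P.keepsNat 2 && P.keepsNat 3 && P.keepsNat 5 && P.keepsNat 6 &&
    P.keepsNat 7 && P.keepsReal 0

end Program

variable {n m : ℕ} {I : Instance n m} {L N : ℕ}

theorem Setup.of_frame {P : Program} {s s' : Memory} (hs : Setup I L N s) (h : P.Frame s s')
    (hP : P.keepsSetup = true := by rfl) : Setup I L N s' := by
  simp only [Program.keepsSetup, Bool.and_eq_true] at hP
  obtain ⟨⟨⟨⟨⟨⟨⟨h0, h1⟩, h2⟩, h3⟩, h5⟩, h6⟩, h7⟩, hr⟩ := hP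
  obtain ⟨a0, a1, a2, a5, a6, a7, ar⟩ := hs
  constructor
  · rw [h.1 _ h0, a0]
  · rw [h.1 _ h1, a1]
  · rw [h.1 _ h2, h.1 _ h3]
    exact a2
  · rw [h.1 _ h5, a5]
  · rw [h.1 _ h6, a6]
  · rw [h.1 _ h7, a7]
  · rw [h.2 _ hr]
    exact ar

/-- The current assignment. -/
def Memory.assignment (n : ℕ) (s : Memory) : Fin n → ℕ := fun k => s.nat 19 0 k

namespace Program

theorem all_row {Q : Oracle} {s : Memory} (hn : s.nat 0 0 0 = n) :
    (row.tree Q s).All fun s' => ∀ k : Fin n,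
      s'.nat 20 0 k = if s.nat 19 0 k = s.nat 13 0 0 + 1 then 1 else 0 := by
  have := all_loop (Q := Q) (x := 14) (s := s) (e := .var 0)
    (p := .setNat 20 (.const 0) (.var 14)
      ((NatExpr.get 19 (.const 0) (.var 14)).eqInd (.add (.var 13) (.const 1))))
    (fun k s' => ∀ i < k,
      s'.nat 20 0 i = if s.nat 19 0 i = s.nat 13 0 0 + 1 then 1 else 0) (by simp)
    (by
      intro k hk s' b hs' hb hf
      simp only [tree, Coin.All, NatExpr.eval_eqInd, NatExpr.eval, Memory.tick_nat,
        Memory.writeNat_nat, hb.1]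
      intro i hi
      rw [hf.1 19 rfl, hf.1 13 rfl]
      by_cases hik : i = k
      · simp [hik]
      · simpa [hik, hb.2.1 20 (by decide)] using hs' i (by omega))
  exact this.mono fun s' hs' k => hs' k (by simp [NatExpr.eval, hn])

theorem all_evaluate {s : Memory} (hs : Setup I L N s) :
    (evaluate.tree I.oracle s).All fun s' => s'.real 4 0 0 = I.value (s.assignment n) := by
  refine all_seq (mid := fun s' => s'.real 4 0 0 = 0)
    (by simp [tree, Coin.All, NatExpr.eval, RealExpr.eval]) fun s1 hf h0 => ?_
  have hs1 := hs.of_frame hf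
  have ha : s1.assignment n = s.assignment n := by
    unfold Memory.assignment
    rw [hf.1 19 rfl]
  rw [← ha]
  have := all_loop (Q := I.oracle) (x := 13) (s := s1) (e := .var 1)
    (p := .seq row (.seq (.query 2 (.const 0) (.const 0) (.var 13) 20 (.const 0))
      (.setReal 4 (.const 0) (.const 0) (.add (.var 4)
        (.mul (.get 0 (.const 0) (.var 13)) (.var 2))))))
    (fun k s' => s'.real 4 0 0 = ∑ j : Fin m, if (j : ℕ) < k then I.revenue j *
      (I.supplier j).demand (univ.filter fun i => s1.assignment n i = j + 1) else 0)
    (by simp [h0]) (by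
      intro k hk s' b hs' hb hf
      simp only [NatExpr.eval, hs1.suppliers] at hk
      have hbs := hs1.of_frame hf
      refine all_seq (all_row hbs.consumers) fun c hc hrow => ?_
      have hcs := hbs.of_frame hc
      simp only [tree, Coin.bind, Coin.All, NatExpr.eval, RealExpr.eval, Memory.tick_nat,
        Memory.tick_real, Memory.writeReal_real, Memory.writeReal_nat]
      have hq := I.oracle_eq (⟨k, hk⟩ : Fin m) (A := {k | c.nat 20 0 k ≠ 0})
        (C := univ.filter fun i => s1.assignment n i = k + 1) (by
          intro i
          simp only [Set.mem_ofPred_eq, hrow i, hf.1 19 rfl, hb.1, mem_filter, mem_univ, true_and]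
          simp [Memory.assignment])
      rw [hc.1 13 rfl, hb.1]
      simp only [hq]
      have hr := hcs.revenue ⟨k, hk⟩
      simp only [hc.2 4 rfl, hb.2.2, hs']
      have h3 : ∀ f : Fin m → ℝ, (∑ j : Fin m, if (j : ℕ) < k + 1 then f j else 0) =
          (∑ j : Fin m, if (j : ℕ) < k then f j else 0) + f ⟨k, hk⟩ := by
        intro f
        rw [← sum_filter, ← sum_filter, add_comm (∑ a with _, f a), ← sum_insert (by simp)]
        congr 1
        ext j
        simp only [mem_filter, mem_univ, true_and, mem_insert, Fin.ext_iff]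
        omega
      rw [h3]
      simp [hr])
  refine this.mono fun s' hs' => ?_
  rw [hs', Instance.value]
  refine sum_congr rfl fun j _ => if_pos ?_
  simp [NatExpr.eval, hs1.suppliers]

theorem all_estimate {s : Memory} (hs : Setup I L N s) (i : Fin n) (hi : s.nat 11 0 0 = i) :
    (estimate.tree I.oracle s).All fun s' => ∀ j : Fin m,
      s'.real 1 0 j = s.real 1 0 j + I.gain (s.assignment n) i (j + 1) := by
  have := all_loop (Q := I.oracle) (x := 13) (s := s) (e := .var 1)
    (p := .seq row (.seq (.setNat 20 (.const 0) (.var 11) (.const 0))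
    (.seq (.query 2 (.const 0) (.const 0) (.var 13) 20 (.const 0))
    (.seq (.setNat 20 (.const 0) (.var 11) (.const 1))
    (.seq (.query 3 (.const 0) (.const 0) (.var 13) 20 (.const 0))
    (.setReal 1 (.const 0) (.var 13) (.add (.get 1 (.const 0) (.var 13))
      (.mul (.get 0 (.const 0) (.var 13)) (.sub (.var 3) (.var 2))))))))))
    (fun k s' => ∀ j : Fin m, s'.real 1 0 j = s.real 1 0 j +
      if (j : ℕ) < k then I.gain (s.assignment n) i (j + 1) else 0)
    (by simp) (by
      intro k hk s' b hs' hb hf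
      simp only [NatExpr.eval, hs.suppliers] at hk
      have hbs := hs.of_frame hf
      refine all_seq (all_row hbs.consumers) fun c hc hrow => ?_
      have hcs := hbs.of_frame hc
      have hr := hcs.revenue ⟨k, hk⟩
      have c11 : c.nat 11 0 0 = i := by rw [hc.1 11 rfl, hf.1 11 rfl, hi]
      have c13 : c.nat 13 0 0 = k := by rw [hc.1 13 rfl, hb.1]
      -- Forcing the cell of i to 0 and then to 1 queries the supplier's set without i and with i,
      -- whatever i is assigned to. The nested conditional in the second set records the two
      -- successive writes.
      have hq0 := I.oracle_eq (⟨k, hk⟩ : Fin m)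
        (A := {l | (if l = (i : ℕ) then 0 else c.nat 20 0 l) ≠ 0})
        (C := (univ.filter fun l => s.assignment n l = k + 1).erase i) (by
          intro l
          simp only [Set.mem_ofPred_eq, hrow l, hf.1 19 rfl, hb.1, mem_filter, mem_univ, true_and,
            mem_erase, Fin.val_inj]
          simp [Memory.assignment])
      have hq1 := I.oracle_eq (⟨k, hk⟩ : Fin m)
        (A := {l | (if l = (i : ℕ) then 1 else if l = (i : ℕ) then 0 else c.nat 20 0 l) ≠ 0})
        (C := insert i (univ.filter fun l => s.assignment n l = k + 1)) (by
          intro l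
          simp only [Set.mem_ofPred_eq, hrow l, hf.1 19 rfl, hb.1, mem_filter, mem_univ, true_and,
            mem_insert, Fin.val_inj]
          simp only [Memory.assignment]
          split_ifs with h <;> simp [*])
      simp only [tree, Coin.bind, Coin.All, NatExpr.eval, RealExpr.eval, Memory.tick_nat,
        Memory.tick_real, Memory.writeReal_real, Memory.writeReal_nat, Memory.writeNat_nat,
        Memory.writeNat_real, c11, c13]
      simp only [true_and, false_and, and_true, and_self, if_true, if_false, Nat.reduceEqDiff,
        OfNat.one_ne_ofNat, OfNat.zero_ne_ofNat, hq0, hq1, hr]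
      intro j
      rw [hc.2 1 rfl, hb.2.2]
      by_cases hj : (j : ℕ) = k
      · have : j = ⟨k, hk⟩ := Fin.ext hj
        subst this
        have h1 := hs' ⟨k, hk⟩
        have h2 := I.gain_succ (s.assignment n) i ⟨k, hk⟩
        simp only [lt_irrefl, if_false, add_zero] at h1 h2
        simp [h1, h2]
      · have : (j : ℕ) ≤ k ↔ (j : ℕ) < k := by omega
        simp [hj, hs', this])
  refine this.mono fun s' hs' j => ?_
  rw [hs' j, if_pos]
  simp [NatExpr.eval, hs.suppliers]

theorem all_clear {Q : Oracle} {s : Memory} (hs : Setup I L N s) :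
    (clear.tree Q s).All fun s' => ∀ j : Fin m, s'.real 1 0 j = 0 := by
  have := all_loop (Q := Q) (x := 13) (s := s) (e := .var 1)
    (p := .setReal 1 (.const 0) (.var 13) (.const 0))
    (fun k s' => ∀ j < k, s'.real 1 0 j = 0) (by simp)
    (by
      intro k hk s' b hs' hb hf
      simp only [tree, Coin.All, NatExpr.eval, RealExpr.eval, Memory.tick_real,
        Memory.writeReal_real, hb.1]
      intro j hj
      by_cases hjk : j = k
      · simp [hjk]
      · simpa [hjk, hb.2.2] using hs' j (by omega))
  exact this.mono fun s' hs' j => hs' j (by simp [NatExpr.eval, hs.suppliers])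

theorem all_argmax {Q : Oracle} {s : Memory} (hs : Setup I L N s) (hm : 0 < m) :
    (argmax.tree Q s).All fun s' => ∃ b : Fin m, s'.nat 21 0 0 = (b : ℕ) ∧
      ∀ j : Fin m, s.real 1 0 j ≤ s.real 1 0 b := by
  refine all_seq (mid := fun s' => s'.nat 21 0 0 = 0)
    (by simp [tree, Coin.All, NatExpr.eval]) fun s1 hf h0 => ?_
  have hs1 := hs.of_frame hf
  rw [← hf.2 1 rfl]
  have := all_loop (Q := Q) (x := 13) (s := s1) (e := .var 1)
    (p := .ite (.realLe (.get 1 (.const 0) (.var 21)) (.get 1 (.const 0) (.var 13)))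
      (.setNat 21 (.const 0) (.const 0) (.var 13)) .skip)
    (fun k s' => ∃ b : Fin m, s'.nat 21 0 0 = (b : ℕ) ∧
      ∀ j : Fin m, (j : ℕ) < k → s1.real 1 0 j ≤ s1.real 1 0 b) ⟨⟨0, hm⟩, by simp [h0], by simp⟩
    (by
      rintro k hk s' b ⟨a, ha, ha'⟩ hb hf
      simp only [NatExpr.eval, hs1.suppliers] at hk
      have e21 : b.nat 21 0 0 = a := by rw [hb.2.1 21 (by decide), ha]
      simp only [tree, Test.Holds, RealExpr.eval, NatExpr.eval, hb.1, e21, hf.2 1 rfl]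
      split_ifs with h
      · refine ⟨⟨k, hk⟩, by simp [hb.1], fun j hj => ?_⟩
        rcases Nat.lt_succ_iff_lt_or_eq.1 hj with hj | hj
        · exact (ha' j hj).trans h
        · simp [hj]
      · refine ⟨a, by simp [e21], fun j hj => ?_⟩
        rcases Nat.lt_succ_iff_lt_or_eq.1 hj with hj | hj
        · exact ha' j hj
        · rw [hj]
          exact (not_le.1 h).le)
  refine this.mono fun s' ⟨b, hb, hb'⟩ => ⟨b, hb, fun j => hb' j ?_⟩
  simp [NatExpr.eval, hs1.suppliers]

end Program

end Assortment

/-! ### Greedy choice by sampling, and progress per column. -/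

namespace Assortment

open Finset BigOperators

/-- Effect of one more sample on the total squared error of the estimates. -/
theorem expect_sum_sq_le {Ω κ : Type} [Fintype Ω] [Nonempty Ω] [Fintype κ] {g : κ → Ω → ℝ} {M : ℝ}
    (X : κ → ℝ) (k : ℝ) (h0 : ∀ j ω, 0 ≤ g j ω) (hM : ∀ j ω, g j ω ≤ M) :
    𝔼 ω, ∑ j, (X j + g j ω - (k + 1) * 𝔼 ω, g j ω) ^ 2 ≤
      ∑ j, (X j - k * 𝔼 ω, g j ω) ^ 2 + Fintype.card κ * M ^ 2 := by
  rw [expect_sum_comm]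
  have h1 : ∀ j ∈ (univ : Finset κ), 𝔼 ω, (X j + g j ω - (k + 1) * 𝔼 ω, g j ω) ^ 2 ≤
      (X j - k * 𝔼 ω, g j ω) ^ 2 + M ^ 2 := by
    intro j _
    refine le_trans (le_of_eq ?_) (expect_sq_add_sub_le (X j - k * 𝔼 ω, g j ω) (h0 j) (hM j))
    refine expect_congr rfl fun ω _ => ?_
    ring
  refine (sum_le_sum h1).trans (le_of_eq ?_)
  rw [sum_add_distrib, sum_const, card_univ, nsmul_eq_mul]

namespace Program

variable {n m : ℕ} {I : Instance n m} {L N : ℕ}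

theorem all_set_choice {Q : Oracle} {s : Memory} (hs : Setup I L N s) (hm : 0 < m) {i : Fin n}
    (hi : s.nat 11 0 0 = i) :
    ((seq argmax (.setNat 18 (.var 11) (.var 10) (.add (.var 21) (.const 1)))).tree Q s).All
      fun s' => ∃ b : Fin m, (∀ j : Fin m, s.real 1 0 j ≤ s.real 1 0 b) ∧
        s'.nat 18 = tableSet (s.nat 18) i (s.nat 10 0 0) (b + 1) := by
  refine all_seq (all_argmax hs hm) fun s1 hf ⟨b, hb, hb'⟩ => ⟨b, hb', ?_⟩
  ext i' t'
  simp [tableSet, NatExpr.eval, hb, hf.1 11 rfl, hf.1 10 rfl, hf.1 18 rfl, hi]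

theorem all_choose {Q : Oracle} {s : Memory} (hs : Setup I L N s) (hm : 0 < m) {i : Fin n}
    (hi : s.nat 11 0 0 = i) :
    (choose.tree Q s).All fun s' => ∃ b : Fin m,
      s'.nat 18 = tableSet (s.nat 18) i (s.nat 10 0 0) (b + 1) := by
  refine all_seq (Coin.all_true _) fun s1 hf _ => all_seq (Coin.all_true _) fun s2 hf2 _ => ?_
  refine (all_set_choice ((hs.of_frame hf).of_frame hf2) hm (i := i) ?_).mono
    fun s' ⟨b, _, hb⟩ => ⟨b, ?_⟩
  · rw [hf2.1 11 rfl, hf.1 11 rfl, hi]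
  · rw [hb, hf2.1 18 rfl, hf2.1 10 rfl, hf.1 18 rfl, hf.1 10 rfl]

/-- The potential is the total squared error of the sums, which grows in mean by at most m * M ^ 2
per sample; at the end `le_of_isMax_estimate` turns it into a loss of gain. The target φ enters
through an affine lower bound in the gain, the form that `roundPotential_succ` supplies. -/
theorem le_E_choose (hq : ∀ j, IsCoverage (I.supplier j).demand) {s : Memory}
    (hs : Setup I L N s) (hN : 0 < N) {i : Fin n} (hi : s.nat 11 0 0 = i) {M ε : ℝ} (hε : 0 < ε)
    (hM : ∀ j : Fin m, I.value (Function.update (fun _ => 0) i (j + 1)) ≤ M)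
    {φ : Memory → ℝ} {c a : ℝ} (ha : 0 ≤ a)
    (h : ∀ s', ∀ b : Fin m, s'.nat 18 = tableSet (s.nat 18) i (s.nat 10 0 0) (b + 1) →
      c + a * I.mixGain (2 ^ L) (s.nat 18) i (b + 1) ≤ φ s') (j : Fin m) :
    c + a * (I.mixGain (2 ^ L) (s.nat 18) i (j + 1) - (ε + m * M ^ 2 / (N * ε))) ≤
      (choose.tree I.oracle s).E φ := by
  have hm : 0 < m := j.pos
  have hN' : (0 : ℝ) < N := by exact_mod_cast hN
  set D : Fin m → ℝ := fun j => I.mixGain (2 ^ L) (s.nat 18) i (j + 1) with hD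
  refine le_E_seq (all_clear hs) fun s1 hf1 h0 => ?_
  have hs1 := hs.of_frame hf1
  rw [tree, Coin.E_bind]
  -- The term with N - k reserves the mean error of the samples still to come. At k = 0 the reserve
  -- is everything and equals the claimed loss.
  set Φ : ℕ → Memory → ℝ := fun k s' => c + a * (D j - ε -
    (∑ j : Fin m, (s'.real 1 0 j - k * D j) ^ 2 + ((N : ℝ) - k) * (m * M ^ 2)) / (N ^ 2 * ε)) with hΦ
  have hend : ∀ s2, (loop 12 (.var 7) (.seq sample estimate)).Frame s1 s2 →
      Φ N s2 ≤ ((seq argmax (.setNat 18 (.var 11) (.var 10) (.add (.var 21) (.const 1)))).tree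
        I.oracle s2).E φ := by
    intro s2 hf2
    refine ((all_set_choice (hs1.of_frame hf2) hm (i := i) ?_).mono
      fun s3 ⟨b, hb, hb'⟩ => le_trans ?_ (h s3 b ?_)).le_E
    · rw [hf2.1 11 rfl, hf1.1 11 rfl, hi]
    · have := le_of_isMax_estimate (D := D) (X := fun j : Fin m => s2.real 1 0 j) hN' hε hb j
      simp only [hΦ, sub_self, zero_mul, add_zero]
      gcongr
    · rw [hb', hf2.1 18 rfl, hf1.1 18 rfl, hf2.1 10 rfl, hf1.1 10 rfl]
  refine le_trans ?_ (le_E_of_frame hend)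
  have hloop := le_E_loop (Q := I.oracle) (x := 12) (e := .var 7) (p := .seq sample estimate)
    (s := s1) (fun _ _ => True) Φ trivial (fun k _ s' b _ _ _ => Coin.all_true _) (by
      intro k hk s' b _ hb hf
      have hbs := hs1.of_frame hf
      have h18 : b.nat 18 = s.nat 18 := by rw [hf.1 18 rfl, hf1.1 18 rfl]
      rw [tree, Coin.E_bind]
      have hsam := le_E_sample (Q := I.oracle) (s := b) hbs.consumers
        (φ := fun c => (estimate.tree I.oracle c).E (Φ (k + 1)))
        (fun ρ => c + a * (D j - ε - (∑ j : Fin m, (s'.real 1 0 j + I.gain ρ i (j + 1) -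
          (k + 1) * D j) ^ 2 + ((N : ℝ) - (k + 1)) * (m * M ^ 2)) / (N ^ 2 * ε))) (by
            intro c hc _
            refine ((all_estimate (hbs.of_frame hc) i ?_).mono fun d hd => ?_).le_E
            · rw [hc.1 11 rfl, hf.1 11 rfl, hf1.1 11 rfl, hi]
            · simp only [hΦ, hd, hc.2 1 rfl, hb.2.2]
              push_cast
              exact le_rfl)
      rw [hbs.exponent, h18] at hsam
      refine le_trans ?_ hsam
      have : Nonempty (Fin n → Fin (2 ^ L)) := ⟨fun _ => ⟨0, by positivity⟩⟩
      have hg := expect_sum_sq_le (Ω := Fin n → Fin (2 ^ L)) (κ := Fin m)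
        (g := fun j σ => I.gain (fun k => s.nat 18 k (σ k)) i (j + 1)) (M := M)
        (fun j => s'.real 1 0 j) k (fun j σ => I.gain_nonneg hq _ _ _)
        (fun j σ => (I.gain_le_value hq _ _ _).trans (hM j))
      have e1 : ∀ j : Fin m, 𝔼 σ : Fin n → Fin (2 ^ L),
        I.gain (fun k => s.nat 18 k (σ k)) i (j + 1) = D j := fun j => rfl
      simp only [e1, Fintype.card_fin] at hg
      have e2 : ∀ S R : ℝ, c + a * (D j - ε - (S + R) / (N ^ 2 * ε)) =
          (c + a * (D j - ε - R / (N ^ 2 * ε))) - (a / (N ^ 2 * ε)) * S := by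
        intro S R
        ring
      simp only [hΦ, e2]
      rw [expect_sub_distrib, expect_const univ_nonempty, ← mul_expect]
      have h3 := mul_le_mul_of_nonneg_left hg (show 0 ≤ a / (N ^ 2 * ε) by positivity)
      rw [mul_add] at h3
      have e3 : c + a * (D j - ε - ((N : ℝ) - (k + 1)) * (m * M ^ 2) / (N ^ 2 * ε)) =
        c + a * (D j - ε - ((N : ℝ) - k) * (m * M ^ 2) / (N ^ 2 * ε)) +
          a / (N ^ 2 * ε) * (m * M ^ 2) := by ring
      rw [e3]
      linarith)
  simp only [NatExpr.eval, hs1.samples] at hloop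
  refine le_trans (le_of_eq ?_) hloop
  have hz : ∑ j : Fin m, (s1.real 1 0 j - 0 * D j) ^ 2 = 0 := by simp [h0]
  have : (N : ℝ) * (m * M ^ 2) / (N ^ 2 * ε) = m * M ^ 2 / (N * ε) := by
    field_simp
  simp only [hΦ, Memory.tick_real, Nat.cast_zero, hz, sub_zero, zero_add, this, sub_sub]
  rfl

/-- The table is filled up to row `i` of column `t`. -/
structure Filled (I : Instance n m) (L : ℕ) (i₀ : Fin n) (v t i : ℕ) (h : ℕ → ℕ → ℕ) : Prop where
  first : ∀ u < 2 ^ L, h i₀ u = v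
  rest : ∀ k : Fin n, k ≠ i₀ → ∀ u < 2 ^ L, t < u ∨ u = t ∧ i ≤ k → h k u = 0
  eligible : ∀ k : Fin n, ∀ u < 2 ^ L, h k u ≠ 0 → I.Eligible k

theorem Filled.skip {i₀ : Fin n} {v t i : ℕ} {h : ℕ → ℕ → ℕ} (hF : Filled I L i₀ v t i h) :
    Filled I L i₀ v t (i + 1) h :=
  ⟨hF.first, fun k hk u hu hut => hF.rest k hk u hu (by omega), hF.eligible⟩

theorem Filled.next {i₀ : Fin n} {v t : ℕ} {h : ℕ → ℕ → ℕ} (hF : Filled I L i₀ v t n h) :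
    Filled I L i₀ v (t + 1) 0 h :=
  ⟨hF.first, fun k hk u hu hut => hF.rest k hk u hu (by omega), hF.eligible⟩

theorem Filled.set {i₀ : Fin n} {v t : ℕ} {i : Fin n} {h : ℕ → ℕ → ℕ}
    (hF : Filled I L i₀ v t i h) (hi : i ≠ i₀) (hI : I.Eligible i) (w : ℕ) :
    Filled I L i₀ v t (i + 1) (tableSet h i t w) := by
  refine ⟨fun u hu => ?_, fun k hk u hu hut => ?_, fun k u hu hku => ?_⟩
  · rw [tableSet, if_neg (fun hc => hi (Fin.ext hc.1.symm))]
    exact hF.first u hu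
  · rw [tableSet, if_neg (by omega)]
    exact hF.rest k hk u hu (by omega)
  · by_cases hki : k = i
    · exact hki ▸ hI
    · rw [tableSet, if_neg (fun hc => hki (Fin.ext hc.1))] at hku
      exact hF.eligible k u hu hku

/-- The current entry has to be chosen by sampling. -/
theorem step_test_iff {s : Memory} (hs : Setup I L N s) {i i₀ : Fin n} (hi : s.nat 11 0 0 = i)
    (hi₀ : s.nat 8 0 0 = i₀) :
    (Test.conj (Program.eligible (.var 11))
      (.neg (.conj (.natLe (.var 11) (.var 8)) (.natLe (.var 8) (.var 11))))).Holds s ↔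
      I.Eligible i ∧ i ≠ i₀ := by
  simp only [Test.Holds, Program.eligible, NatExpr.eval, hi, hi₀, hs.eligible]
  rw [← le_antisymm_iff, Fin.val_inj]

theorem all_step {Q : Oracle} {s : Memory} (hs : Setup I L N s) (hm : 0 < m) {i i₀ : Fin n}
    (hi : s.nat 11 0 0 = i) (hi₀ : s.nat 8 0 0 = i₀) {v : ℕ}
    (hF : Filled I L i₀ v (s.nat 10 0 0) i (s.nat 18)) :
    (step.tree Q s).All fun s' => Filled I L i₀ v (s.nat 10 0 0) (i + 1) (s'.nat 18) := by
  have ht := step_test_iff hs hi hi₀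
  rw [step, tree]
  split_ifs with hc
  · rw [ht] at hc
    refine (all_choose (s := s.tick _) ⟨hs.1, hs.2, hs.3, hs.4, hs.5, hs.6, hs.7⟩ hm hi).mono ?_
    rintro s' ⟨b, hb⟩
    rw [hb]
    exact hF.set hc.2 hc.1 _
  · exact hF.skip

theorem le_E_step (hq : ∀ j, IsCoverage (I.supplier j).demand) {s : Memory}
    (hs : Setup I L N s) (hm : 0 < m) (hN : 0 < N) {i i₀ : Fin n} (hi : s.nat 11 0 0 = i)
    (hi₀ : s.nat 8 0 0 = i₀) {v : ℕ} (ht : s.nat 10 0 0 < 2 ^ L)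
    (hF : Filled I L i₀ v (s.nat 10 0 0) i (s.nat 18)) {M ε : ℝ} (hε : 0 < ε)
    {o : Fin n → ℕ} (ho : ∀ i, o i ≠ 0 → I.Eligible i) (hom : ∀ i, o i ≤ m)
    (hM : ∀ i, I.Eligible i → ∀ j : Fin m, I.value (Function.update (fun _ => 0) i (j + 1)) ≤ M) :
    I.roundPotential (2 ^ L) o i₀ i (s.nat 18) - (ε + m * M ^ 2 / (N * ε)) / (2 ^ L : ℕ) ≤
      (step.tree I.oracle s).E fun s' => I.roundPotential (2 ^ L) o i₀ (i + 1) (s'.nat 18) := by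
  have htest := step_test_iff hs hi hi₀
  have hT : (0 : ℝ) < (2 ^ L : ℕ) := by positivity
  rw [step, tree]
  split_ifs with hc
  · rw [htest] at hc
    have hii : (i : ℕ) ≠ i₀ := fun h => hc.2 (Fin.ext h)
    have h0 : s.nat 18 i (s.nat 10 0 0) = 0 := hF.rest i hc.2 _ ht (by omega)
    have key := fun k => le_E_choose hq (s := s.tick k) ⟨hs.1, hs.2, hs.3, hs.4, hs.5, hs.6, hs.7⟩ hN hi hε
      (hM i hc.1) (φ := fun s' => I.roundPotential (2 ^ L) o i₀ (i + 1) (s'.nat 18))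
      (c := I.roundPotential (2 ^ L) o i₀ i (s.nat 18) -
        I.mixGain (2 ^ L) (s.nat 18) i (o i) / (2 ^ L : ℕ)) (a := 1 / (2 ^ L : ℕ)) (by positivity)
      (by
        intro s' b hb
        have := I.roundPotential_succ hq (o := o) hii ht h0 (b + 1)
        simp only [hb, Memory.tick_nat]
        refine le_trans (le_of_eq ?_) this
        ring)
    -- The choice competes with suppliers only. If o leaves i unassigned, its gain is 0 and any
    -- supplier does as well.
    have hj : ∃ j : Fin m, I.mixGain (2 ^ L) (s.nat 18) i (o i) ≤
        I.mixGain (2 ^ L) (s.nat 18) i (j + 1) := by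
      rcases Nat.eq_zero_or_pos (o i) with h | h
      · refine ⟨⟨0, hm⟩, ?_⟩
        rw [h, I.mixGain_zero]
        exact I.mixGain_nonneg hq _ _ _ _
      · have := hom i
        refine ⟨⟨o i - 1, by omega⟩, ?_⟩
        rw [Nat.sub_add_cancel h]
    obtain ⟨j, hj⟩ := hj
    refine le_trans ?_ (key _ j)
    simp only [Memory.tick_nat]
    have h2 := div_le_div_of_nonneg_right hj hT.le
    rw [one_div_mul_eq_div, sub_div]
    linarith
  · rw [htest] at hc
    -- A skipped consumer is i₀ or ineligible; an ineligible one is unassigned in o, so it promises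
    -- no gain.
    have hη : 0 ≤ (ε + m * M ^ 2 / (N * ε)) / (2 ^ L : ℕ) := by positivity
    simp only [tree, Coin.E, Memory.tick_nat]
    rw [I.roundPotential_succ_of_skip]
    · linarith
    · by_cases h : i = i₀
      · exact Or.inl (congrArg _ h)
      · refine Or.inr (by_contra fun h' => hc ⟨ho i h', h⟩)

theorem all_column {Q : Oracle} {s : Memory} (hs : Setup I L N s) (hm : 0 < m) {i₀ : Fin n}
    (hi₀ : s.nat 8 0 0 = i₀) {v : ℕ} (hF : Filled I L i₀ v (s.nat 10 0 0) 0 (s.nat 18)) :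
    ((loop 11 (.var 0) step).tree Q s).All fun s' =>
      Filled I L i₀ v (s.nat 10 0 0 + 1) 0 (s'.nat 18) := by
  have := all_loop (Q := Q) (x := 11) (e := .var 0) (p := step) (s := s)
    (fun k s' => Filled I L i₀ v (s.nat 10 0 0) k (s'.nat 18)) hF (by
      intro k hk s' b hs' hb hf
      simp only [NatExpr.eval, hs.consumers] at hk
      rw [← hf.1 10 rfl]
      refine all_step (i := ⟨k, hk⟩) (hs.of_frame hf) hm hb.1 ((congrFun₂ (hf.1 8 rfl) 0 0).trans hi₀) ?_
      rw [hb.2.1 18 (by decide), hf.1 10 rfl]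
      exact hs')
  refine this.mono fun s' hs' => Filled.next ?_
  simpa only [NatExpr.eval, hs.consumers] using hs'

/-- Each of the n consumers costs at most η/T of potential. Lowering the target from the value of o
to W absorbs these errors exactly and leaves a clean contraction by 1 + 1/T. -/
theorem le_E_column (hq : ∀ j, IsCoverage (I.supplier j).demand) {s : Memory}
    (hs : Setup I L N s) (hm : 0 < m) (hN : 0 < N) {i₀ : Fin n}
    (hi₀ : s.nat 8 0 0 = i₀) (ht : s.nat 10 0 0 < 2 ^ L) {M ε : ℝ} (hε : 0 < ε)
    {o : Fin n → ℕ} (ho : ∀ i, o i ≠ 0 → I.Eligible i) (hom : ∀ i, o i ≤ m)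
    (hF : Filled I L i₀ (o i₀) (s.nat 10 0 0) 0 (s.nat 18))
    (hM : ∀ i, I.Eligible i → ∀ j : Fin m, I.value (Function.update (fun _ => 0) i (j + 1)) ≤ M)
    {W : ℝ} (hW : W = I.value o - n * (ε + m * M ^ 2 / (N * ε))) :
    I.mix (2 ^ L) (s.nat 18) - W ≤ (1 + 1 / (2 ^ L : ℕ)) *
      ((loop 11 (.var 0) step).tree I.oracle s).E fun s' => I.mix (2 ^ L) (s'.nat 18) - W := by
  set η := ε + m * M ^ 2 / (N * ε) with hη
  have hT : (0 : ℝ) < (2 ^ L : ℕ) := by positivity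
  have h1 := le_E_loop (Q := I.oracle) (x := 11) (e := .var 0) (p := step) (s := s)
    (fun k s' => Filled I L i₀ (o i₀) (s.nat 10 0 0) k (s'.nat 18))
    (fun k s' => I.roundPotential (2 ^ L) o i₀ k (s'.nat 18) + (k * (η / (2 ^ L : ℕ)) - W)) hF (by
      intro k hk s' b hs' hb hf
      simp only [NatExpr.eval, hs.consumers] at hk
      rw [← hf.1 10 rfl]
      refine all_step (i := ⟨k, hk⟩) (hs.of_frame hf) hm hb.1 ((congrFun₂ (hf.1 8 rfl) 0 0).trans hi₀) ?_
      rw [hb.2.1 18 (by decide), hf.1 10 rfl]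
      exact hs') (by
      intro k hk s' b hs' hb hf
      simp only [NatExpr.eval, hs.consumers] at hk
      have h10 : b.nat 10 0 0 = s.nat 10 0 0 := by rw [hf.1 10 rfl]
      have h18 : b.nat 18 = s'.nat 18 := hb.2.1 18 (by decide)
      have := le_E_step hq (s := b) (i := ⟨k, hk⟩) (hs.of_frame hf) hm hN hb.1
        ((congrFun₂ (hf.1 8 rfl) 0 0).trans hi₀) (h10 ▸ ht) (by rw [h10, h18]; exact hs') hε ho hom hM
      rw [Coin.E_add, Coin.E_const]
      simp only [← hη, h18] at this
      push_cast at this ⊢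
      linarith)
  have hn : NatExpr.eval s (.var 0) = n := by simp [NatExpr.eval, hs.consumers]
  rw [hn] at h1
  rw [I.roundPotential_zero] at h1
  rw [← Coin.E_mul]
  refine le_trans (le_of_eq ?_) (h1.trans ?_)
  · simp only [Memory.tick_nat, Nat.cast_zero]
    ring
  · refine ((all_column hs hm hi₀ hF).mono fun s' hs' => ?_).E_le_E
    have := I.roundPotential_le hq (T := 2 ^ L) (by positivity) i₀ hs'.first
    have e1 : (1 + 1 / ((2 ^ L : ℕ) : ℝ)) * (I.mix (2 ^ L) (s'.nat 18) - W) =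
      (1 + 1 / ((2 ^ L : ℕ) : ℝ)) * I.mix (2 ^ L) (s'.nat 18) - I.value o / (2 ^ L : ℕ) +
        (n * (η / (2 ^ L : ℕ)) - W) := by
      rw [hW]
      ring
    rw [e1]
    linarith

theorem all_fill {Q : Oracle} {s : Memory} (hs : Setup I L N s) (hm : 0 < m) {i₀ : Fin n}
    (hi₀ : s.nat 8 0 0 = i₀) {v : ℕ} (hF : Filled I L i₀ v 0 0 (s.nat 18)) :
    (fill.tree Q s).All fun s' => Filled I L i₀ v (2 ^ L) 0 (s'.nat 18) := by
  have := all_loop (Q := Q) (x := 10) (e := .var 5) (p := .loop 11 (.var 0) step) (s := s)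
    (fun k s' => Filled I L i₀ v k 0 (s'.nat 18)) hF (by
      intro k hk s' b hs' hb hf
      have := all_column (Q := Q) (hs.of_frame hf) hm ((congrFun₂ (hf.1 8 rfl) 0 0).trans hi₀)
        (v := v) (by rw [hb.1, hb.2.1 18 (by decide)]; exact hs')
      rwa [hb.1] at this)
  simp only [NatExpr.eval, hs.columns] at this
  exact this

/-- By `le_E_column` the quantity a ^ k * (`mix` - W) does not decrease in mean from column to
column; after 2 ^ L columns the power is divided out. -/
theorem le_E_fill (hq : ∀ j, IsCoverage (I.supplier j).demand) {s : Memory}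
    (hs : Setup I L N s) (hm : 0 < m) (hN : 0 < N) {i₀ : Fin n}
    (hi₀ : s.nat 8 0 0 = i₀) {M ε : ℝ} (hε : 0 < ε)
    {o : Fin n → ℕ} (ho : ∀ i, o i ≠ 0 → I.Eligible i) (hom : ∀ i, o i ≤ m)
    (hF : Filled I L i₀ (o i₀) 0 0 (s.nat 18))
    (hM : ∀ i, I.Eligible i → ∀ j : Fin m, I.value (Function.update (fun _ => 0) i (j + 1)) ≤ M)
    {W : ℝ} (hW : W = I.value o - n * (ε + m * M ^ 2 / (N * ε))) :
    W + ((1 + 1 / ((2 ^ L : ℕ) : ℝ)) ^ (2 ^ L))⁻¹ * (I.mix (2 ^ L) (s.nat 18) - W) ≤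
      (fill.tree I.oracle s).E fun s' => I.mix (2 ^ L) (s'.nat 18) := by
  set a := 1 + 1 / ((2 ^ L : ℕ) : ℝ) with ha
  have ha0 : 0 < a := by positivity
  have h1 := le_E_loop (Q := I.oracle) (x := 10) (e := .var 5) (p := .loop 11 (.var 0) step)
    (s := s) (fun k s' => Filled I L i₀ (o i₀) k 0 (s'.nat 18))
    (fun k s' => a ^ k * (I.mix (2 ^ L) (s'.nat 18) - W)) hF (by
      intro k hk s' b hs' hb hf
      have := all_column (Q := I.oracle) (hs.of_frame hf) hm
        ((congrFun₂ (hf.1 8 rfl) 0 0).trans hi₀)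
        (v := o i₀) (by rw [hb.1, hb.2.1 18 (by decide)]; exact hs')
      rwa [hb.1] at this) (by
      intro k hk s' b hs' hb hf
      simp only [NatExpr.eval, hs.columns] at hk
      have h18 : b.nat 18 = s'.nat 18 := hb.2.1 18 (by decide)
      have := le_E_column hq (s := b) (hs.of_frame hf) hm hN
        ((congrFun₂ (hf.1 8 rfl) 0 0).trans hi₀) (by rw [hb.1]; exact hk) hε ho hom
        (by rw [hb.1, h18]; exact hs') hM hW
      rw [h18] at this
      rw [Coin.E_mul, pow_succ, mul_assoc]
      exact mul_le_mul_of_nonneg_left this (by positivity))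
  rw [Coin.E_mul] at h1
  simp only [NatExpr.eval, hs.columns, pow_zero, one_mul, Memory.tick_nat] at h1
  have h2 : ((fill.tree I.oracle s).E fun s' => I.mix (2 ^ L) (s'.nat 18) - W) =
      ((fill.tree I.oracle s).E fun s' => I.mix (2 ^ L) (s'.nat 18)) - W := by
    simp only [sub_eq_add_neg]
    rw [Coin.E_add, Coin.E_const]
  have h3 := mul_le_mul_of_nonneg_left h1 (inv_nonneg.2 (pow_nonneg ha0.le (2 ^ L)))
  rw [← mul_assoc, inv_mul_cancel₀ (pow_ne_zero _ ha0.ne'), one_mul] at h3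
  change _ ≤ (fill.tree I.oracle s).E (fun s' => I.mix (2 ^ L) (s'.nat 18) - W) at h3
  linarith

end Program

end Assortment

/-! ### Attempts from a fixed pair, and keeping the best assignment. -/

namespace Assortment

open Finset BigOperators

/-- The output array holds a feasible assignment, and its value is recorded. -/
def Recorded {n m : ℕ} (I : Instance n m) (s : Memory) : Prop :=
  ∃ ρ : Fin n → ℕ, (∀ i, ρ i ≠ 0 → I.Eligible i) ∧
    (∀ (i : Fin n) (j : Fin m), s.nat 4 i j ≠ 0 ↔ ρ i = j + 1) ∧ s.real 5 0 0 = I.value ρ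

variable {n m : ℕ} {I : Instance n m} {L N : ℕ}

theorem Recorded.congr {s s' : Memory} (hs : Recorded I s) (h4 : s'.nat 4 = s.nat 4)
    (h5 : s'.real 5 = s.real 5) : Recorded I s' := by
  obtain ⟨ρ, h1, h2, h3⟩ := hs
  exact ⟨ρ, h1, by rwa [h4], by rwa [h5]⟩

namespace Program

theorem all_start {Q : Oracle} {s : Memory} (hs : Setup I L N s) {i₀ : Fin n}
    (hi₀ : s.nat 8 0 0 = i₀) :
    (start.tree Q s).All fun s' => ∀ k : Fin n, ∀ u < 2 ^ L,
      s'.nat 18 k u = Function.update (fun _ => 0) i₀ (s.nat 9 0 0 + 1) k := by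
  have hclear := all_loop (Q := Q) (x := 11) (e := .var 0)
    (p := .loop 10 (.var 5) (.setNat 18 (.var 11) (.var 10) (.const 0))) (s := s)
    (fun k s' => ∀ i < k, ∀ u < 2 ^ L, s'.nat 18 i u = 0) (by simp) (by
      intro k hk s' b hs' hb hf
      have := all_loop (Q := Q) (x := 10) (e := .var 5)
        (p := .setNat 18 (.var 11) (.var 10) (.const 0)) (s := b)
        (fun t c => (∀ i < k, ∀ u < 2 ^ L, c.nat 18 i u = 0) ∧ ∀ u < t, c.nat 18 k u = 0)
        ⟨by rw [← hb.2.1 18 (by decide)] at hs'; exact hs', by simp⟩ (by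
          intro t ht c d hc hd hg
          have h11 : d.nat 11 0 0 = k := by rw [hg.1 11 rfl, hb.1]
          rw [← hd.2.1 18 (by decide)] at hc
          simp only [tree, Coin.All, NatExpr.eval, Memory.tick_nat, Memory.writeNat_nat, h11, hd.1]
          refine ⟨fun i hi u hu => ?_, fun u hu => ?_⟩
          · simpa [hi.ne] using hc.1 i hi u hu
          · by_cases hut : u = t
            · simp [hut]
            · simpa [hut] using hc.2 u (by omega))
      refine this.mono fun c hc i hi u hu => ?_
      simp only [NatExpr.eval, (hs.of_frame hf).columns] at hc
      rcases Nat.lt_succ_iff_lt_or_eq.1 hi with hi | hi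
      · exact hc.1 i hi u hu
      · rw [hi]
        exact hc.2 u hu)
  refine all_seq hclear fun s1 hf h1 => ?_
  simp only [NatExpr.eval, hs.consumers] at h1
  have := all_loop (Q := Q) (x := 10) (e := .var 5)
    (p := .setNat 18 (.var 8) (.var 10) (.add (.var 9) (.const 1))) (s := s1)
    (fun t c => (∀ k : Fin n, k ≠ i₀ → ∀ u < 2 ^ L, c.nat 18 k u = 0) ∧
      ∀ u < t, c.nat 18 i₀ u = s.nat 9 0 0 + 1) ⟨fun k _ => h1 k k.2, by simp⟩ (by
      intro t ht c d hc hd hg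
      have h8 : d.nat 8 0 0 = i₀ := by rw [hg.1 8 rfl, hf.1 8 rfl, hi₀]
      have h9 : d.nat 9 0 0 = s.nat 9 0 0 := by rw [hg.1 9 rfl, hf.1 9 rfl]
      rw [← hd.2.1 18 (by decide)] at hc
      simp only [tree, Coin.All, NatExpr.eval, Memory.tick_nat, Memory.writeNat_nat, h8, h9, hd.1]
      refine ⟨fun k hk u hu => ?_, fun u hu => ?_⟩
      · simpa [Fin.val_inj, hk] using hc.1 k hk u hu
      · by_cases hut : u = t
        · simp [hut]
        · simpa [hut] using hc.2 u (by omega))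
  refine this.mono fun c hc k u hu => ?_
  simp only [NatExpr.eval, (hs.of_frame hf).columns] at hc
  by_cases hk : k = i₀
  · rw [hk, Function.update_self]
    exact hc.2 u hu
  · rw [Function.update_of_ne hk]
    exact hc.1 k hk u hu

theorem all_write {Q : Oracle} {s : Memory} (hs : Setup I L N s) :
    (write.tree Q s).All fun s' => ∀ (i : Fin n) (j : Fin m),
      s'.nat 4 i j = if s.nat 19 0 i = j + 1 then 1 else 0 := by
  have := all_loop (Q := Q) (x := 11) (e := .var 0)
    (p := .loop 13 (.var 1) (.setNat 4 (.var 11) (.var 13)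
      ((NatExpr.get 19 (.const 0) (.var 11)).eqInd (.add (.var 13) (.const 1))))) (s := s)
    (fun k s' => ∀ i < k, ∀ j < m, s'.nat 4 i j = if s.nat 19 0 i = j + 1 then 1 else 0)
    (by simp) (by
      intro k hk s' b hs' hb hf
      have := all_loop (Q := Q) (x := 13) (e := .var 1)
        (p := .setNat 4 (.var 11) (.var 13)
          ((NatExpr.get 19 (.const 0) (.var 11)).eqInd (.add (.var 13) (.const 1)))) (s := b)
        (fun t c => (∀ i < k, ∀ j < m, c.nat 4 i j = if s.nat 19 0 i = j + 1 then 1 else 0) ∧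
          ∀ j < t, c.nat 4 k j = if s.nat 19 0 k = j + 1 then 1 else 0)
        ⟨by rw [← hb.2.1 4 (by decide)] at hs'; exact hs', by simp⟩ (by
          intro t ht c d hc hd hg
          have h11 : d.nat 11 0 0 = k := by rw [hg.1 11 rfl, hb.1]
          rw [← hd.2.1 4 (by decide)] at hc
          simp only [tree, Coin.All, NatExpr.eval_eqInd, NatExpr.eval, Memory.tick_nat,
            Memory.writeNat_nat, h11, hd.1, hg.1 19 rfl, hf.1 19 rfl]
          refine ⟨fun i hi u hu => ?_, fun u hu => ?_⟩
          · simpa [hi.ne] using hc.1 i hi u hu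
          · by_cases hut : u = t
            · simp [hut]
            · simpa [hut] using hc.2 u (by omega))
      refine this.mono fun c hc i hi j hj => ?_
      simp only [NatExpr.eval, (hs.of_frame hf).suppliers] at hc
      rcases Nat.lt_succ_iff_lt_or_eq.1 hi with hi | hi
      · exact hc.1 i hi j hj
      · rw [hi]
        exact hc.2 j hj)
  simp only [NatExpr.eval, hs.consumers] at this
  exact this.mono fun s' hs' i j => hs' i i.2 j j.2

theorem all_record {Q : Oracle} {s : Memory} (hs : Setup I L N s) (hr : Recorded I s)
    (hE : ∀ i, s.assignment n i ≠ 0 → I.Eligible i)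
    (h4 : s.real 4 0 0 = I.value (s.assignment n)) :
    (record.tree Q s).All fun s' => Recorded I s' ∧ s.real 5 0 0 ≤ s'.real 5 0 0 ∧
      s.real 4 0 0 ≤ s'.real 5 0 0 := by
  rw [record, tree]
  split_ifs with hc
  · simp only [Test.Holds, RealExpr.eval, NatExpr.eval] at hc
    refine all_seq (mid := fun s1 => s1.real 5 0 0 = s.real 4 0 0)
      (by simp [tree, Coin.All, NatExpr.eval, RealExpr.eval]) fun s1 hf h5 => ?_
    have hs1 : Setup I L N s1 := Setup.of_frame (s := s.tick _)
      ⟨hs.1, hs.2, hs.3, hs.4, hs.5, hs.6, hs.7⟩ hf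
    have h19 : s1.nat 19 = s.nat 19 := hf.1 19 rfl
    refine ((all_write hs1).and (all_frame _ _)).mono fun s' hs' => ?_
    have e5 : s'.real 5 0 0 = s.real 4 0 0 := by rw [hs'.2.2 5 rfl, h5]
    refine ⟨⟨s.assignment n, hE, fun i j => ?_, e5.trans h4⟩, e5 ▸ hc, e5.ge⟩
    rw [hs'.1 i j, h19]
    change _ ↔ s.nat 19 0 i = j + 1
    split_ifs with h <;> simp [h]
  · simp only [Test.Holds, RealExpr.eval, NatExpr.eval, not_le] at hc
    exact ⟨hr.congr rfl rfl, le_rfl, hc.le⟩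

theorem all_finish {s : Memory} (hs : Setup I L N s) (hr : Recorded I s)
    (hE : ∀ k : Fin n, ∀ u < 2 ^ L, s.nat 18 k u ≠ 0 → I.Eligible k) :
    ((seq sample (.seq evaluate record)).tree I.oracle s).All fun s' =>
      Recorded I s' ∧ s.real 5 0 0 ≤ s'.real 5 0 0 := by
  refine all_seq (all_sample s) fun s1 hf1 h1 => ?_
  refine all_seq (all_evaluate (hs.of_frame hf1)) fun s2 hf2 h2 => ?_
  have ha : s2.assignment n = s1.assignment n := by
    unfold Memory.assignment
    rw [hf2.1 19 rfl]
  refine (all_record ((hs.of_frame hf1).of_frame hf2) (hr.congr ?_ ?_) ?_ (ha ▸ h2)).mono ?_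
  · rw [hf2.1 4 rfl, hf1.1 4 rfl]
  · rw [hf2.2 5 rfl, hf1.2 5 rfl]
  · intro i hi
    rw [ha, Memory.assignment] at hi
    obtain ⟨t, ht, h⟩ := h1 i (by rw [hs.consumers]; exact i.2)
    rw [hs.exponent] at ht
    exact hE i t ht (h ▸ hi)
  · intro s' hs'
    rw [hf2.2 5 rfl, hf1.2 5 rfl] at hs'
    exact ⟨hs'.1, hs'.2.1⟩

/-- An assignment drawn from the table has mean value `mix`. Its value is computed exactly, and the
recorded value ends up at least as large. -/
theorem le_E_finish {s : Memory} (hs : Setup I L N s) (hr : Recorded I s)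
    (hE : ∀ k : Fin n, ∀ u < 2 ^ L, s.nat 18 k u ≠ 0 → I.Eligible k) :
    I.mix (2 ^ L) (s.nat 18) ≤ ((seq sample (.seq evaluate record)).tree I.oracle s).E fun s' =>
      s'.real 5 0 0 := by
  rw [tree, Coin.E_bind]
  have := le_E_sample (Q := I.oracle) (s := s) hs.consumers
    (φ := fun c => ((seq evaluate record).tree I.oracle c).E fun s' => s'.real 5 0 0) I.value (by
      intro s1 hf1 h1
      refine le_E_seq (all_evaluate (hs.of_frame hf1)) fun s2 hf2 h2 => ?_
      have ha : s2.assignment n = s1.assignment n := by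
        unfold Memory.assignment
        rw [hf2.1 19 rfl]
      refine ((all_record ((hs.of_frame hf1).of_frame hf2) (hr.congr ?_ ?_) ?_ (ha ▸ h2)).mono
        ?_).le_E
      · rw [hf2.1 4 rfl, hf1.1 4 rfl]
      · rw [hf2.2 5 rfl, hf1.2 5 rfl]
      · intro i hi
        rw [ha, Memory.assignment] at hi
        obtain ⟨t, ht, h⟩ := h1 i i.2
        rw [hs.exponent] at ht
        exact hE i t ht (h ▸ hi)
      · intro s' hs'
        rw [h2] at hs'
        exact hs'.2.2)
  rw [hs.exponent] at this
  exact this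

theorem Filled.of_start {i₀ : Fin n} {v : ℕ} {h : ℕ → ℕ → ℕ} (hI : I.Eligible i₀)
    (hh : ∀ k : Fin n, ∀ u < 2 ^ L, h k u = Function.update (fun _ => 0) i₀ v k) :
    Filled I L i₀ v 0 0 h := by
  refine ⟨fun u hu => ?_, fun k hk u hu _ => ?_, fun k u hu hku => ?_⟩
  · rw [hh i₀ u hu, Function.update_self]
  · rw [hh k u hu, Function.update_of_ne hk]
  · by_cases hk : k = i₀
    · exact hk ▸ hI
    · rw [hh k u hu, Function.update_of_ne hk] at hku
      exact absurd rfl hku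

theorem all_attempt {s : Memory} (hs : Setup I L N s) (hr : Recorded I s) (hm : 0 < m) {i₀ : Fin n}
    (hi₀ : s.nat 8 0 0 = i₀) :
    (attempt.tree I.oracle s).All fun s' => Recorded I s' ∧ s.real 5 0 0 ≤ s'.real 5 0 0 := by
  rw [attempt, tree]
  split_ifs with hc
  · simp only [Test.Holds, Program.eligible, NatExpr.eval, hi₀, hs.eligible] at hc
    have hs0 : ∀ k, Setup I L N (s.tick k) := fun k => ⟨hs.1, hs.2, hs.3, hs.4, hs.5, hs.6, hs.7⟩
    refine all_seq (all_start (hs0 _) hi₀) fun s1 hf1 h1 => ?_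
    have hs1 := (hs0 _).of_frame hf1
    have h8 : s1.nat 8 0 0 = i₀ := (congrFun₂ (hf1.1 8 rfl) 0 0).trans hi₀
    refine all_seq (all_fill hs1 hm h8 (Filled.of_start hc h1)) fun s2 hf2 h2 => ?_
    refine (all_finish (hs1.of_frame hf2) (hr.congr ?_ ?_) h2.eligible).mono fun s' hs' => ?_
    · rw [hf2.1 4 rfl, hf1.1 4 rfl]
      rfl
    · rw [hf2.2 5 rfl, hf1.2 5 rfl]
      rfl
    · rw [hf2.2 5 rfl, hf1.2 5 rfl] at hs'
      exact hs'
  · exact ⟨hr.congr rfl rfl, le_rfl⟩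

theorem le_E_attempt (hq : ∀ j, IsCoverage (I.supplier j).demand) {s : Memory}
    (hs : Setup I L N s) (hr : Recorded I s) (hm : 0 < m) (hN : 144 * (n + m) ^ 5 ≤ N)
    (hL : 2 * n ≤ 2 ^ L) {o : Fin n → ℕ} (ho : ∀ i, o i ≠ 0 → I.Eligible i) (hom : ∀ i, o i ≤ m)
    (hmax : ∀ ρ, (∀ i, ρ i ≠ 0 → I.Eligible i) → I.value ρ ≤ I.value o) (hW : 0 < I.value o)
    {i₀ : Fin n} (hi₀ : s.nat 8 0 0 = i₀) (hj₀ : o i₀ = s.nat 9 0 0 + 1)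
    (h₀ : I.value o / n ≤ I.value (Function.update (fun _ => 0) i₀ (o i₀))) :
    (1 - Real.exp (-1)) * I.value o ≤ (attempt.tree I.oracle s).E fun s' => s'.real 5 0 0 := by
  have hI₀ : I.Eligible i₀ := ho i₀ (by omega)
  have hn : 0 < n := i₀.pos
  have hn' : (1 : ℝ) ≤ n := by exact_mod_cast hn
  rw [attempt, tree, if_pos (by
    simp only [Test.Holds, Program.eligible, NatExpr.eval, hi₀, hs.eligible, hI₀])]
  have hs0 : ∀ k, Setup I L N (s.tick k) := fun k => ⟨hs.1, hs.2, hs.3, hs.4, hs.5, hs.6, hs.7⟩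
  refine le_E_seq (all_start (hs0 _) hi₀) fun s1 hf1 h1 => ?_
  have hs1 := (hs0 _).of_frame hf1
  have h8 : s1.nat 8 0 0 = i₀ := (congrFun₂ (hf1.1 8 rfl) 0 0).trans hi₀
  have hF := Filled.of_start hI₀ h1
  rw [tree, Coin.E_bind]
  set W := I.value o with hWdef
  -- With this ε, at least 144 * n ^ 4 * m samples make the statistical loss at most ε, so n
  -- consumers lose at most 2nε = W/(6n) in all. The number 144 * (n + m) ^ 5 is large enough.
  set ε := W / (12 * n ^ 2) with hε
  have hε0 : 0 < ε := by positivity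
  have hN0 : 0 < N := by
    have : 0 < 144 * (n + m) ^ 5 := by positivity
    omega
  -- A single eligible pair is itself a feasible assignment, so W bounds all gains and can serve as
  -- M.
  have hfill := le_E_fill hq hs1 hm hN0 h8 (M := W) (ε := ε) hε0 ho hom
    (by rw [hj₀]; exact hF) (fun i hi j => hmax _ fun k hk => by
      by_cases hki : k = i
      · exact hki ▸ hi
      · rw [Function.update_of_ne hki] at hk
        exact absurd rfl hk) rfl
  have hmono : ((fill.tree I.oracle s1).E fun s' => I.mix (2 ^ L) (s'.nat 18)) ≤
      (fill.tree I.oracle s1).E fun s2 =>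
        ((seq sample (.seq evaluate record)).tree I.oracle s2).E fun s' => s'.real 5 0 0 := by
    refine (((all_fill hs1 hm h8 hF).and (all_frame _ _)).mono fun s2 h2 => ?_).E_le_E
    refine le_E_finish (hs1.of_frame h2.2) (hr.congr ?_ ?_) h2.1.eligible
    · rw [h2.2.1 4 rfl, hf1.1 4 rfl]
      rfl
    · rw [h2.2.2 5 rfl, hf1.2 5 rfl]
      rfl
  refine le_trans ?_ (hfill.trans hmono)
  have hmix : I.mix (2 ^ L) (s1.nat 18) = I.value (Function.update (fun _ => 0) i₀ (o i₀)) := by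
    rw [hj₀]
    exact I.mix_of_const (by positivity) h1
  rw [hmix]
  have hmain := one_sub_exp_mul_le hn hL hW.le h₀
  refine hmain.trans ?_
  have hη : (n : ℝ) * (ε + m * W ^ 2 / (N * ε)) ≤ W / (6 * n) := by
    have hN1 : (144 : ℝ) * n ^ 4 * m ≤ N := by
      have h2 : 144 * n ^ 4 * m ≤ N := by
        refine le_trans ?_ hN
        rw [mul_assoc, pow_succ (n + m) 4]
        gcongr <;> omega
      exact_mod_cast h2
    have hNr : (0 : ℝ) < N := by exact_mod_cast hN0
    have h3 : m * W ^ 2 / (N * ε) ≤ ε := by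
      rw [div_le_iff₀ (by positivity)]
      have h4 : ε * (N * ε) = N * (W ^ 2 / (144 * n ^ 4)) := by
        rw [hε]
        field_simp
        ring
      rw [h4]
      calc (m : ℝ) * W ^ 2 = 144 * n ^ 4 * m * (W ^ 2 / (144 * n ^ 4)) := by
            field_simp
        _ ≤ _ := by gcongr
    calc (n : ℝ) * (ε + m * W ^ 2 / (N * ε)) ≤ n * (ε + ε) := by gcongr
      _ = W / (6 * n) := by
        rw [hε]
        field_simp
        norm_num
  set x := ((1 + 1 / ((2 ^ L : ℕ) : ℝ)) ^ (2 ^ L))⁻¹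
  -- The bound is a convex combination of the target and the starting value, hence monotone in the
  -- target, and a loss estimate in one direction suffices.
  have hx : x ≤ 1 := inv_le_one_of_one_le₀ (one_le_pow₀ (by simp))
  nlinarith

/-- A loop that never decreases `β` and makes it large in round `k₀`. -/
theorem le_E_loop_of_round {Q : Oracle} {x : ℕ} {e : NatExpr} {p : Program} {s : Memory}
    (Inv : Memory → Prop) (β : Memory → ℝ) (h0 : Inv (s.tick (e.cost + 1)))
    (h : ∀ k < e.eval s, ∀ s' b, Inv s' → Enters x k s' b → (loop x e p).Frame s b →
      (p.tree Q b).All fun c => Inv c ∧ β s' ≤ β c) {k₀ : ℕ} (hk₀ : k₀ < e.eval s) {V : ℝ}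
    (hV : ∀ s' b, Inv s' → Enters x k₀ s' b → (loop x e p).Frame s b → V ≤ (p.tree Q b).E β) :
    V ≤ ((loop x e p).tree Q s).E β := by
  have := le_E_loop (Q := Q) (x := x) (e := e) (p := p) (s := s) (fun _ => Inv)
    -- The potential is the constant V until round k₀ has been run and β afterwards, so it jumps
    -- exactly once.
    (fun k s' => if k ≤ k₀ then V else β s') h0
    (fun k hk s' b hs' hb hf => (h k hk s' b hs' hb hf).mono fun c hc => hc.1)
    (fun k hk s' b hs' hb hf => by
      rcases lt_trichotomy k k₀ with hkk | hkk | hkk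
      · simp [hkk.le, Nat.succ_le_of_lt hkk, Coin.E_const]
      · subst hkk
        simpa using hV s' b hs' hb hf
      · simp only [not_le.2 hkk, not_le.2 (hkk.trans (Nat.lt_succ_self k)), if_false]
        exact ((h k hk s' b hs' hb hf).mono fun c hc => hc.2).le_E)
  simpa [not_le.2 hk₀] using this

theorem all_attempts_inner {s : Memory} (hs : Setup I L N s) (hr : Recorded I s) {i₀ : Fin n}
    (hi₀ : s.nat 8 0 0 = i₀) :
    ((loop 9 (.var 1) attempt).tree I.oracle s).All fun s' =>
      Recorded I s' ∧ s.real 5 0 0 ≤ s'.real 5 0 0 := by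
  refine all_loop (x := 9) (e := .var 1) (fun _ s' => Recorded I s' ∧ s.real 5 0 0 ≤ s'.real 5 0 0)
    ⟨hr.congr rfl rfl, le_rfl⟩ fun k hk s' b hs' hb hf => ?_
  simp only [NatExpr.eval, hs.suppliers] at hk
  refine (all_attempt (hs.of_frame hf) (hs'.1.congr (hb.2.1 4 (by decide)) (by rw [hb.2.2]))
    (Nat.zero_lt_of_lt hk) ((congrFun₂ (hf.1 8 rfl) 0 0).trans hi₀)).mono fun c hc => ⟨hc.1, ?_⟩
  rw [hb.2.2] at hc
  exact hs'.2.trans hc.2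

theorem all_attempts {s : Memory} (hs : Setup I L N s) (hr : Recorded I s) :
    (attempts.tree I.oracle s).All (Recorded I) := by
  refine all_loop (x := 8) (e := .var 0) (fun _ => Recorded I) (hr.congr rfl rfl)
    fun k hk s' b hs' hb hf => ?_
  simp only [NatExpr.eval, hs.consumers] at hk
  exact (all_attempts_inner (i₀ := ⟨k, hk⟩) (hs.of_frame hf)
    (hs'.congr (hb.2.1 4 (by decide)) (by rw [hb.2.2])) hb.1).mono fun c hc => hc.1

/-- Only the attempt that starts from a pair of o worth at least an nth part of its value is
analysed; recorded values never decrease in the other attempts. -/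
theorem le_E_attempts (hq : ∀ j, IsCoverage (I.supplier j).demand) {s : Memory}
    (hs : Setup I L N s) (hr : Recorded I s) (hN : 144 * (n + m) ^ 5 ≤ N)
    (hL : 2 * n ≤ 2 ^ L) {o : Fin n → ℕ} (ho : ∀ i, o i ≠ 0 → I.Eligible i) (hom : ∀ i, o i ≤ m)
    (hmax : ∀ ρ, (∀ i, ρ i ≠ 0 → I.Eligible i) → I.value ρ ≤ I.value o) (hW : 0 < I.value o) :
    (1 - Real.exp (-1)) * I.value o ≤ (attempts.tree I.oracle s).E fun s' => s'.real 5 0 0 := by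
  have hn : 0 < n := by
    rcases Nat.eq_zero_or_pos n with rfl | hn
    · have : o = fun _ => 0 := funext fun i => i.elim0
      rw [this, I.value_zero hq] at hW
      exact absurd hW (lt_irrefl _)
    · exact hn
  obtain ⟨i₀, h₀⟩ := I.exists_single_value_ge hq hn o
  have hoi : o i₀ ≠ 0 := by
    intro h
    rw [h, Function.update_eq_self_iff.2 rfl, I.value_zero hq] at h₀
    have : 0 < I.value o / n := by positivity
    linarith
  have hj₀ : o i₀ - 1 < m := by
    have := hom i₀
    omega
  refine le_E_loop_of_round (x := 8) (e := .var 0) (Recorded I) (fun s' => s'.real 5 0 0)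
    (hr.congr rfl rfl) (fun k hk s' b hs' hb hf => ?_) (k₀ := i₀)
    (by simp [NatExpr.eval, hs.consumers]) fun s' b hs' hb hf => ?_
  · simp only [NatExpr.eval, hs.consumers] at hk
    rw [← hb.2.2]
    exact all_attempts_inner (i₀ := ⟨k, hk⟩) (hs.of_frame hf)
      (hs'.congr (hb.2.1 4 (by decide)) (by rw [hb.2.2])) hb.1
  · have hbs := hs.of_frame hf
    refine le_E_loop_of_round (x := 9) (e := .var 1) (Recorded I) (fun s' => s'.real 5 0 0)
      (hs'.congr (hb.2.1 4 (by decide)) (by rw [← hb.2.2]; rfl))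
      (fun k hk c d hc hd hg => ?_) (k₀ := o i₀ - 1)
      (by simp [NatExpr.eval, hbs.suppliers, hj₀]) fun c d hc hd hg => ?_
    · simp only [NatExpr.eval, hbs.suppliers] at hk
      rw [← hd.2.2]
      exact all_attempt (i₀ := i₀) (hbs.of_frame hg)
        (hc.congr (hd.2.1 4 (by decide)) (by rw [hd.2.2])) (Nat.zero_lt_of_lt hk)
        ((congrFun₂ (hg.1 8 rfl) 0 0).trans hb.1)
    · exact le_E_attempt hq (hbs.of_frame hg)
        (hc.congr (hd.2.1 4 (by decide)) (by rw [hd.2.2])) (Nat.zero_lt_of_lt hj₀) hN hL ho hom hmax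
        hW ((congrFun₂ (hg.1 8 rfl) 0 0).trans hb.1) (by rw [hd.1]; omega) h₀

end Program

end Assortment

/-! ### Parameters of the algorithm and conclusion. -/

namespace Assortment

open Finset BigOperators

variable {n m : ℕ} {I : Instance n m} {L N : ℕ}

theorem Instance.input_nat_zero (I : Instance n m) (i j : ℕ) :
    I.input.nat 0 i j = if i = 0 ∧ j = 0 then n else 0 := by
  by_cases h : i = 0 ∧ j = 0
  · simp [Instance.input, h]
  · simp only [Instance.input, h]
    cases I.budget <;> simp

theorem Instance.input_nat_one (I : Instance n m) (i j : ℕ) :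
    I.input.nat 1 i j = if i = 0 ∧ j = 0 then m else 0 := by
  by_cases h : i = 0 ∧ j = 0
  · simp [Instance.input, h]
  · simp only [Instance.input, h]
    cases I.budget <;> simp

namespace Program

theorem two_mul_le_two_pow (n : ℕ) : 2 * n ≤ 2 ^ n := by
  rcases n with - | n
  · simp
  · have : n < 2 ^ n := Nat.lt_two_pow_self
    rw [pow_succ]
    omega

/-- Doubling stops once 2n is reached, and n rounds suffice because 2n ≤ 2 ^ n. The last doubling
starts below 2n, whence the bound 4n; the added 1 covers n = 0. -/
theorem all_tableSize {Q : Oracle} {s : Memory} (hn : s.nat 0 0 0 = n)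
    (h5 : ∀ i j, s.nat 5 i j = 0) (h6 : ∀ i j, s.nat 6 i j = 0) :
    (tableSize.tree Q s).All fun s' => ∃ L ≤ n, s'.nat 5 0 0 = 2 ^ L ∧ s'.nat 6 0 0 = L ∧
      2 * n ≤ 2 ^ L ∧ (∀ i j, s'.nat 5 i j ≤ 4 * n + 1) ∧ ∀ i j, s'.nat 6 i j ≤ n := by
  refine all_seq (mid := fun s1 => s1.nat 5 0 0 = 1 ∧ ∀ i j, s1.nat 5 i j ≤ 1) ?_
    fun s1 hf h1 => ?_
  · simp only [tree, Coin.All, NatExpr.eval, Memory.tick_nat, Memory.writeNat_nat, h5]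
    refine ⟨by simp, fun i j => ?_⟩
    split_ifs <;> omega
  have hn1 : s1.nat 0 0 0 = n := by rw [hf.1 0 rfl, hn]
  have := all_loop (Q := Q) (x := 15) (e := .var 0)
    (p := .ite (.natLe (.add (.var 0) (.var 0)) (.var 5)) .skip
      (.seq (.setNat 5 (.const 0) (.const 0) (.add (.var 5) (.var 5)))
        (.setNat 6 (.const 0) (.const 0) (.add (.var 6) (.const 1))))) (s := s1)
    (fun k c => ∃ L ≤ k, c.nat 5 0 0 = 2 ^ L ∧ c.nat 6 0 0 = L ∧ (L = k ∨ 2 * n ≤ 2 ^ L) ∧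
      (∀ i j, c.nat 5 i j ≤ 4 * n + 1) ∧ ∀ i j, c.nat 6 i j ≤ n)
    ⟨0, le_rfl, h1.1, by rw [Memory.tick_nat, hf.1 6 rfl, h6], Or.inl rfl,
      fun i j => (h1.2 i j).trans (by omega),
      fun i j => by rw [Memory.tick_nat, hf.1 6 rfl, h6]; omega⟩ (by
      rintro k hk s' b ⟨L, hL, e5, e6, hLk, b5, b6⟩ hb hg
      simp only [NatExpr.eval, hn1] at hk
      have h0 : b.nat 0 0 0 = n := by rw [hg.1 0 rfl, hn1]
      rw [← hb.2.1 5 (by decide)] at e5 b5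
      rw [← hb.2.1 6 (by decide)] at e6 b6
      rw [tree]
      split_ifs with hc
      · simp only [Test.Holds, NatExpr.eval, h0, e5] at hc
        exact ⟨L, by omega, e5, e6, Or.inr (by omega), b5, b6⟩
      · simp only [Test.Holds, NatExpr.eval, h0, e5] at hc
        simp only [tree, Coin.bind, Coin.All, NatExpr.eval, Memory.tick_nat, Memory.writeNat_nat]
        refine ⟨L + 1, by omega, ?_, by simp [e6], Or.inl ?_, fun i j => ?_, fun i j => ?_⟩
        · simp [e5, pow_succ]
          omega
        · rcases hLk with h | h
          · rw [h]
          · omega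
        · have := b5 i j
          simp only [Nat.reduceEqDiff, false_and, if_false]
          split_ifs <;> omega
        · have := b6 i j
          simp only [Nat.reduceEqDiff, false_and, if_false]
          split_ifs <;> omega)
  refine this.mono ?_
  rintro s' ⟨L, hL, e5, e6, hLk, b5, b6⟩
  simp only [NatExpr.eval, hn1] at hL hLk
  refine ⟨L, hL, e5, e6, ?_, b5, b6⟩
  rcases hLk with rfl | h
  · exact two_mul_le_two_pow _
  · exact h

/-- Natural numbers cannot be multiplied in one step, so each of the five factors n + m is produced
by repeated addition. -/
theorem all_sampleSize {Q : Oracle} {s : Memory} (hn : s.nat 0 0 0 = n) (hm : s.nat 1 0 0 = m)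
    (h7 : ∀ i j, s.nat 7 i j = 0) :
    (sampleSize.tree Q s).All fun s' => s'.nat 7 0 0 = 144 * (n + m) ^ 5 ∧
      ∀ i j, s'.nat 7 i j ≤ 144 * (n + m) ^ 5 := by
  refine all_seq (mid := fun s1 => s1.nat 7 0 0 = 144 ∧
    ∀ i j, ¬ (i = 0 ∧ j = 0) → s1.nat 7 i j = 0) ?_ fun s1 hf h1 => ?_
  · simp +contextual [tree, Coin.All, NatExpr.eval, h7]
  have hn1 : s1.nat 0 0 0 = n := by rw [hf.1 0 rfl, hn]
  have hm1 : s1.nat 1 0 0 = m := by rw [hf.1 1 rfl, hm]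
  have := all_loop (Q := Q) (x := 15) (e := .const 5)
    (p := .seq (.setNat 22 (.const 0) (.const 0) (.const 0))
      (.seq (.loop 23 (.add (.var 0) (.var 1))
        (.setNat 22 (.const 0) (.const 0) (.add (.var 22) (.var 7))))
      (.setNat 7 (.const 0) (.const 0) (.var 22)))) (s := s1)
    (fun k c => c.nat 7 0 0 = 144 * (n + m) ^ k ∧ ∀ i j, ¬ (i = 0 ∧ j = 0) → c.nat 7 i j = 0)
    (by simpa using h1) (by
      intro k hk s' b hs' hb hg
      rw [← hb.2.1 7 (by decide)] at hs'
      refine all_seq (mid := fun c => c.nat 22 0 0 = 0) (by simp [tree, Coin.All, NatExpr.eval])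
        fun c hc h22 => ?_
      have e0 : c.nat 0 0 0 = n := by rw [hc.1 0 rfl, hg.1 0 rfl, hn1]
      have e1 : c.nat 1 0 0 = m := by rw [hc.1 1 rfl, hg.1 1 rfl, hm1]
      rw [← hc.1 7 rfl] at hs'
      have hsum := all_loop (Q := Q) (x := 23) (e := .add (.var 0) (.var 1))
        (p := .setNat 22 (.const 0) (.const 0) (.add (.var 22) (.var 7))) (s := c)
        (fun l d => d.nat 22 0 0 = l * c.nat 7 0 0) (by simp [h22]) (by
          intro l hl d f hd hf' hgf
          rw [← hf'.2.1 22 (by decide)] at hd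
          simp [tree, Coin.All, NatExpr.eval, hd, hgf.1 7 rfl]
          ring)
      refine all_seq hsum fun d hd h22' => ?_
      simp only [NatExpr.eval, e0, e1, hs'.1] at h22'
      simp only [tree, Coin.All, NatExpr.eval, Memory.tick_nat, Memory.writeNat_nat, h22']
      refine ⟨by simp; ring, fun i j hij => ?_⟩
      rw [if_neg (by tauto), hd.1 7 rfl, hs'.2 i j hij])
  refine this.mono fun s' hs' => ⟨hs'.1, fun i j => ?_⟩
  by_cases hij : i = 0 ∧ j = 0
  · rw [hij.1, hij.2]
    exact hs'.1.le
  · rw [hs'.2 i j hij]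
    exact Nat.zero_le _

/-- Bounds on the entries of the arrays of parameters. -/
noncomputable def paramBound : ℕ → Polynomial ℕ
  | 5 => 4 * Polynomial.X + 1
  | 7 => 144 * Polynomial.X ^ 5
  | _ => Polynomial.X

theorem all_prelude (I : Instance n m) (hq : ∀ j, IsCoverage (I.supplier j).demand) :
    ((seq tableSize sampleSize).tree I.oracle I.input).All fun s =>
      (∃ L, 2 * n ≤ 2 ^ L ∧ Setup I L (144 * (n + m) ^ 5) s) ∧ Recorded I s ∧
      ∀ a ∈ [0, 1, 5, 6, 7], ∀ i j, s.nat a i j ≤ (paramBound a).eval (n + m) := by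
  have hinp : ∀ a i j, a ≠ 0 → a ≠ 1 → a ≠ 2 → a ≠ 3 → I.input.nat a i j = 0 := by
    intro a i j h0 h1 h2 h3
    simp only [Instance.input, h0, h1, h2, h3, false_and, if_false, dif_neg, not_false_iff]
    cases I.budget <;> rfl
  have h00 := I.input_nat_zero
  have h11 := I.input_nat_one
  refine ((all_seq (all_tableSize (n := n) (by simp [h00]) (fun i j => hinp 5 i j (by decide)
    (by decide) (by decide) (by decide)) (fun i j => hinp 6 i j (by decide) (by decide) (by decide)
    (by decide))) fun s1 hf1 h1 => ((all_sampleSize (n := n) (m := m) ?_ ?_ ?_).and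
      (all_frame _ _)).mono fun s2 h2 => (⟨?_, ?_⟩ : (∃ L, 2 * n ≤ 2 ^ L ∧ s2.nat 5 0 0 = 2 ^ L ∧
        s2.nat 6 0 0 = L ∧ s2.nat 7 0 0 = 144 * (n + m) ^ 5) ∧
      ((∀ i j, s2.nat 5 i j ≤ 4 * n + 1) ∧ (∀ i j, s2.nat 6 i j ≤ n) ∧
        ∀ i j, s2.nat 7 i j ≤ 144 * (n + m) ^ 5))).and (all_frame _ _)).mono ?_
  · rw [hf1.1 0 rfl, h00]
    simp
  · rw [hf1.1 1 rfl, h11]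
    simp
  · intro i j
    rw [hf1.1 7 rfl]
    exact hinp 7 i j (by decide) (by decide) (by decide) (by decide)
  · obtain ⟨L, hLn, e5, e6, hL, b5, b6⟩ := h1
    exact ⟨L, hL, by rw [h2.2.1 5 rfl, e5], by rw [h2.2.1 6 rfl, e6], h2.1.1⟩
  · obtain ⟨L, hLn, e5, e6, hL, b5, b6⟩ := h1
    exact ⟨by rwa [h2.2.1 5 rfl], by rwa [h2.2.1 6 rfl], h2.1.2⟩
  · rintro s ⟨⟨⟨L, hL, e5, e6, e7⟩, b5, b6, b7⟩, hf⟩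
    refine ⟨⟨L, hL, ?_, ?_, ?_, e5, e6, e7, ?_⟩, ⟨fun _ => 0, by simp, ?_, ?_⟩, ?_⟩
    · rw [hf.1 0 rfl, h00]
      simp
    · rw [hf.1 1 rfl, h11]
      simp
    · intro i
      rw [hf.1 2 rfl, hf.1 3 rfl]
      -- Without budgets the program's test reads 0 ≤ 0 and always succeeds; with budgets it reads 1
      -- ≤ K i.
      simp only [Instance.input, Instance.Eligible]
      cases I.budget <;> simp
    · intro j
      rw [hf.2 0 rfl]
      simp [Instance.input]
    · intro i j
      rw [hf.1 4 rfl, hinp 4 _ _ (by decide) (by decide) (by decide) (by decide)]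
      simp
    · rw [hf.2 5 rfl, I.value_zero hq]
      simp [Instance.input]
    · intro a ha i j
      simp only [List.mem_cons, List.not_mem_nil, or_false] at ha
      rcases ha with rfl | rfl | rfl | rfl | rfl
      · rw [hf.1 0 rfl, h00]
        simp only [paramBound, Polynomial.eval_X]
        split_ifs <;> omega
      · rw [hf.1 1 rfl, h11]
        simp only [paramBound, Polynomial.eval_X]
        split_ifs <;> omega
      · have := b5 i j
        simp only [paramBound, Polynomial.eval_add, Polynomial.eval_mul, Polynomial.eval_X,
          Polynomial.eval_one, Polynomial.eval_ofNat]
        omega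
      · have := b6 i j
        simp only [paramBound, Polynomial.eval_X]
        omega
      · have := b7 i j
        simpa [paramBound] using this

end Program

/-- Some feasible assignment is best. -/
theorem Instance.exists_isMax_value (I : Instance n m) : ∃ o : Fin n → ℕ,
    (∀ i, o i ≠ 0 → I.Eligible i) ∧ (∀ i, o i ≤ m) ∧
      ∀ ρ, (∀ i, ρ i ≠ 0 → I.Eligible i) → I.value ρ ≤ I.value o := by
  classical
  obtain ⟨o, ho, hmax⟩ := exists_max_image
    (univ.filter fun c : Fin n → Fin (m + 1) => ∀ i, (c i : ℕ) ≠ 0 → I.Eligible i)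
    (fun c => I.value fun i => c i) ⟨fun _ => 0, by simp⟩
  simp only [mem_filter, mem_univ, true_and] at ho hmax
  refine ⟨fun i => o i, ho, fun i => Nat.lt_succ_iff.1 (o i).2, fun ρ hρ => ?_⟩
  -- Entries above m name no supplier. Replacing them by 0 keeps the value and makes the search
  -- finite.
  have h := hmax (fun i => if h : ρ i ≤ m then ⟨ρ i, Nat.lt_succ_of_le h⟩ else 0) (by
    intro i hi
    split_ifs at hi with h
    · exact hρ i hi
    · exact absurd rfl hi)
  refine le_trans (le_of_eq ?_) h
  unfold Instance.value
  refine sum_congr rfl fun j _ => ?_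
  congr 2
  refine filter_congr fun i _ => ?_
  have := j.2
  dsimp only
  split_ifs with h
  · rfl
  · simp
    omega

/-- The algorithm runs in polynomial time, its output is feasible, and its expected revenue is at
least `(1 - 1 / e) / 2` times the optimum. -/
theorem approximation_spec :
    ∃ T : Polynomial ℕ, ∀ (n m : ℕ) (I : Instance n m),
      (∀ i, (I.consumer i).EasyToMatch) → (∀ j, (I.supplier j).IsRandomUtility) →
      (∀ s ∈ (Program.approximation.finalMemory I).support, s.clock ≤ T.eval (n + m)) ∧
      (∀ S ∈ (Program.approximation.outputLaw I).support, I.Feasible S) ∧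
      (1 - Real.exp (-1)) / 2 * I.opt ≤ Program.approximation.expectedRevenue I := by
  -- The running time is bounded in two parts because the first part writes the arrays that govern
  -- the loops of the second.
  refine ⟨(Program.seq Program.tableSize Program.sampleSize).timeBound Program.paramBound +
    Program.attempts.timeBound Program.paramBound, fun n m I hI hU => ?_⟩
  have hq : ∀ j, IsCoverage (I.supplier j).demand := fun j => (hU j).isCoverage
  have hfinal : Program.approximation.finalMemory I =
      (Program.approximation.tree I.oracle I.input).toPMF := Program.run_eq_toPMF _ _ _
  have hrec : (Program.approximation.tree I.oracle I.input).All (Recorded I) :=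
    Program.all_seq (Program.all_prelude I hq) fun s _ ⟨⟨L, _, hs⟩, hr, _⟩ => Program.all_attempts hs hr
  have hout : ∀ s, Recorded I s → ∃ ρ : Fin n → ℕ, (∀ i, ρ i ≠ 0 → I.Eligible i) ∧
      output n m s = Instance.menus ρ ∧ s.real 5 0 0 = I.value ρ := by
    rintro s ⟨ρ, h1, h2, h3⟩
    refine ⟨ρ, h1, ?_, h3⟩
    ext i j
    simp [output, Instance.menus, h2]
  refine ⟨fun s hs => ?_, fun S hS => ?_, ?_⟩
  · rw [hfinal] at hs
    rw [Polynomial.eval_add]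
    refine Coin.All.of_mem_support (p := fun s => s.clock ≤ _) ?_ hs
    have h1 := Program.all_clock_le (Q := I.oracle) (β := Program.paramBound) (F := [0, 1])
      (x := n + m) (P := .seq Program.tableSize Program.sampleSize) (by decide) (by decide)
      (s := I.input) (by
        intro a ha i j
        simp only [List.mem_cons, List.not_mem_nil, or_false] at ha
        rcases ha with rfl | rfl
        · rw [I.input_nat_zero]
          simp only [Program.paramBound, Polynomial.eval_X]
          split_ifs <;> omega
        · rw [I.input_nat_one]
          simp only [Program.paramBound, Polynomial.eval_X]
          split_ifs <;> omega)
    refine Program.all_seq (h1.and (Program.all_prelude I hq)) fun s' _ ⟨hc, _, _, hb⟩ => ?_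
    refine (Program.all_clock_le (F := [0, 1, 5, 6, 7]) (by decide) (by decide) hb).mono
      fun s'' h'' => ?_
    have : I.input.clock = 0 := rfl
    omega
  · rw [Program.outputLaw, PMF.support_map] at hS
    obtain ⟨s, hs, rfl⟩ := hS
    rw [hfinal] at hs
    obtain ⟨ρ, h1, h2, -⟩ := hout s (hrec.of_mem_support hs)
    rw [h2]
    exact I.feasible_menus ρ h1
  · obtain ⟨o, ho, hom, hmax⟩ := I.exists_isMax_value
    have hopt : I.opt ≤ I.value o := I.opt_le hmax
    have he : 0 ≤ 1 - Real.exp (-1) := by simp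
    have hrev : Program.approximation.expectedRevenue I =
        (Program.approximation.tree I.oracle I.input).E
          fun s => I.expectedRevenue (output n m s) := by
      rw [Program.expectedRevenue, Program.outputLaw, hfinal, Coin.sum_toPMF_map]
    have hhalf : ((Program.approximation.tree I.oracle I.input).E fun s => 1 / 2 * s.real 5 0 0) ≤
        Program.approximation.expectedRevenue I := by
      rw [hrev]
      refine (hrec.mono fun s hs => ?_).E_le_E
      obtain ⟨ρ, h1, h2, h3⟩ := hout s hs
      rw [h2, h3]
      exact I.half_value_le hI hq ρ
    rw [Coin.E_mul] at hhalf
    have hmain : (1 - Real.exp (-1)) * I.value o ≤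
        (Program.approximation.tree I.oracle I.input).E fun s => s.real 5 0 0 := by
      -- The sampling accuracy is proportional to the optimum and must be positive, so optimum 0 is
      -- treated separately.
      rcases (I.value_nonneg hq o).eq_or_lt with h0 | hW
      · rw [← h0, mul_zero]
        refine (hrec.mono fun s hs => ?_).le_E
        obtain ⟨ρ, -, -, h3⟩ := hout s hs
        rw [h3]
        exact I.value_nonneg hq ρ
      · exact Program.le_E_seq (Program.all_prelude I hq) fun s _ ⟨⟨L, hL, hs⟩, hr, _⟩ =>
          Program.le_E_attempts hq hs hr le_rfl hL ho hom hmax hW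
    have := mul_le_mul_of_nonneg_left hopt he
    linarith

end Assortment

theorem corollary2 :
    ∃ (P : Assortment.Program) (T : Polynomial ℕ),
      ∀ (n m : ℕ) (I : Assortment.Instance n m),
        (∀ i : Fin n, (I.consumer i).EasyToMatch) →
        (∀ j : Fin m, (I.supplier j).IsRandomUtility) →
        (∀ s ∈ (P.finalMemory I).support, s.clock ≤ T.eval (n + m)) ∧
        (∀ S ∈ (P.outputLaw I).support, I.Feasible S) ∧
        (1 - Real.exp (-1)) / 2 * I.opt ≤ P.expectedRevenue I :=
  ⟨Assortment.Program.approximation, Assortment.approximation_spec⟩
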